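/- There is an absolute constant $C>0$ such that the following holds. Let $N \ge n$ be positive integers and let $p \in (0,1]$. Let $A = (a_{ij})$ be an $N \times n$ random matrix whose entries are independent real-valued random variables with mean zero and such that $$ \mathbb{E}\, |a_{ij}|^2 \le p, \qquad |a_{ij}| \le 1 \ \text{ almost surely} \qquad \text{for every } i,j. $$ Let $B$ be a fixed (non-random) real $n \times N$ matrix such that $\|B\| \le 1$, where $\|\cdot\|$ denotes the spectral norm, i.e. the $\ell_2 \to \ell_2$ operator norm. Then $\|BA\|$ is integrable and $$ \mathbb{E}\, \|BA\| \le C \log^{3/2}\Big(\frac{e}{p}\Big) \sqrt{np + \log(2N)}. $$ -/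

import Mathlib

open MeasureTheory ProbabilityTheory

-- The norm of a real matrix is its spectral norm, the operator norm between Euclidean spaces.
open scoped Matrix.Norms.L2Operator

/-! Symmetrization replaces each entry by half its difference with an independent copy. Cutting the
symmetric entries into dyadic size classes writes `A = ∑ 2⁻ˡ A_l` with at most `2 log (e/p)` terms,
where the entries of `A_l` are symmetric, bounded by `1`, and have first absolute moment at most
`q_l = min 1 (2·4ˡ p)`. The factor `2⁻ˡ` balances the growth of `q_l`, so every class costs at most
a constant times `√log (e/p) · √(np + log 2N)`. The number of classes supplies one more logarithm,
hence the power `3/2`.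

For one class (`SparseFamily.integral_norm_le`) put `D = nq + log 2N`. Up to a factor `4`, the norm
is seen on vectors `∑ 2⁻ᵏ σ_k` with sign vectors `σ_k` such that `∑ 4⁻ᵏ |supp σ_k| ≤ 1`. The coarse
layers, `4ᵏ ≤ nq / log (e/q)`, have total entropy `O(D)`, so a union bound handles their sum as a
single vector. At most `6 log (e/q)` layers remain. With high probability `‖BAσ‖² ≲ D |supp σ|` for
all sign vectors at once, and Cauchy–Schwarz over the remaining layers costs `√log (e/q)`.

Two estimates carry this. `expBdd_norm_sum_sq` bounds `𝔼 exp (l ‖∑ Xᵢ vᵢ‖²)` when `∑ vᵢ vᵢᵀ ≤ 1`, by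
integrating out one variable at a time and updating the quadratic form.
`SparseFamily.measure_level_le` treats a vector of squared norm `m`, with `ℓ = 1 + log (n/m)`. Row
sums are cut at height of order `D/ℓ`: the lower part is subgaussian enough for the quadratic
estimate; the upper part has small `ℓ¹` norm, and the deterministic row bound `6D` turns this into
an `ℓ²` bound. -/

/-- `ExpBdd μ f c` says that `𝔼 exp f ≤ exp c`. -/
def ExpBdd {Ω : Type*} [MeasurableSpace Ω] (μ : Measure Ω) (f : Ω → ℝ) (c : ℝ) : Prop :=
  ∫⁻ ω, ENNReal.ofReal (Real.exp (f ω - c)) ∂μ ≤ 1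

/-! ### Calculus of exponential moments. -/

namespace ExpBdd

variable {Ω : Type*} [MeasurableSpace Ω] {μ : Measure Ω}

theorem mono {f g : Ω → ℝ} {c d : ℝ} (h : ExpBdd μ g d) (hfg : ∀ ω, f ω - c ≤ g ω - d) :
    ExpBdd μ f c :=
  (lintegral_mono fun ω => ENNReal.ofReal_le_ofReal (Real.exp_le_exp.2 (hfg ω))).trans h

theorem mono_right {f : Ω → ℝ} {c d : ℝ} (h : ExpBdd μ f c) (hcd : c ≤ d) : ExpBdd μ f d :=
  h.mono fun ω => by linarith

theorem const [IsProbabilityMeasure μ] {c d : ℝ} (h : d ≤ c) : ExpBdd μ (fun _ => d) c := by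
  have : ENNReal.ofReal (Real.exp (d - c)) ≤ 1 := by
    rw [← ENNReal.ofReal_one]
    exact ENNReal.ofReal_le_ofReal (Real.exp_le_one_iff.2 (by linarith))
  simpa [ExpBdd] using this

theorem iff_lintegral_le {f : Ω → ℝ} {c : ℝ} :
    ExpBdd μ f c ↔
      ∫⁻ ω, ENNReal.ofReal (Real.exp (f ω)) ∂μ ≤ ENNReal.ofReal (Real.exp c) := by
  have h : ∀ ω, ENNReal.ofReal (Real.exp (f ω)) =
      ENNReal.ofReal (Real.exp c) * ENNReal.ofReal (Real.exp (f ω - c)) := fun ω => by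
    rw [← ENNReal.ofReal_mul (Real.exp_pos _).le, ← Real.exp_add]
    ring_nf
  have h0 : ENNReal.ofReal (Real.exp c) ≠ 0 := by simp [Real.exp_pos]
  simp_rw [h]
  rw [lintegral_const_mul' _ _ ENNReal.ofReal_ne_top]
  have := ENNReal.mul_le_mul_iff_right h0 ENNReal.ofReal_ne_top
    (b := ∫⁻ ω, ENNReal.ofReal (Real.exp (f ω - c)) ∂μ) (c := 1)
  rw [mul_one] at this
  exact this.symm

/-- Hölder's inequality. -/
theorem convex_comb {f g : Ω → ℝ} {c d s t : ℝ} (hf : ExpBdd μ f c) (hg : ExpBdd μ g d)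
    (hfm : Measurable f) (hs : 0 ≤ s) (ht : 0 ≤ t) (hst : s + t = 1) :
    ExpBdd μ (fun ω => s * f ω + t * g ω) (s * c + t * d) := by
  have key : ∀ ω, ENNReal.ofReal (Real.exp (s * f ω + t * g ω - (s * c + t * d))) ≤
      ENNReal.ofReal s * ENNReal.ofReal (Real.exp (f ω - c)) +
        ENNReal.ofReal t * ENNReal.ofReal (Real.exp (g ω - d)) := fun ω => by
    rw [← ENNReal.ofReal_mul hs, ← ENNReal.ofReal_mul ht, ← ENNReal.ofReal_add (by positivity)
      (by positivity)]
    refine ENNReal.ofReal_le_ofReal ?_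
    have := convexOn_exp.2 (Set.mem_univ (f ω - c)) (Set.mem_univ (g ω - d)) hs ht hst
    simp only [smul_eq_mul] at this
    have e : s * f ω + t * g ω - (s * c + t * d) = s * (f ω - c) + t * (g ω - d) := by ring
    rw [e]
    exact this
  refine (lintegral_mono key).trans ?_
  rw [lintegral_add_left (by fun_prop), lintegral_const_mul' _ _ ENNReal.ofReal_ne_top,
    lintegral_const_mul' _ _ ENNReal.ofReal_ne_top]
  calc _ ≤ ENNReal.ofReal s * 1 + ENNReal.ofReal t * 1 := by gcongr <;> assumption
    _ = 1 := by rw [mul_one, mul_one, ← ENNReal.ofReal_add hs ht, hst, ENNReal.ofReal_one]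

/-- Jensen's inequality. -/
theorem smul_of_le_one [IsProbabilityMeasure μ] {f : Ω → ℝ} {c s : ℝ} (hf : ExpBdd μ f c)
    (hfm : Measurable f) (hs : 0 ≤ s) (hs1 : s ≤ 1) : ExpBdd μ (fun ω => s * f ω) (s * c) := by
  simpa using hf.convex_comb (const (le_refl (0 : ℝ))) hfm hs (sub_nonneg.2 hs1)
    (add_sub_cancel s 1)

/-- Markov's inequality. -/
theorem measure_le {f : Ω → ℝ} {c : ℝ} (hf : ExpBdd μ f c) (hfm : Measurable f) (t : ℝ) :
    μ {ω | t ≤ f ω} ≤ ENNReal.ofReal (Real.exp (c - t)) := by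
  have h := mul_meas_ge_le_lintegral (μ := μ)
    (f := fun ω => ENNReal.ofReal (Real.exp (f ω - c))) (by fun_prop)
    (ENNReal.ofReal (Real.exp (t - c)))
  have h1 := h.trans hf
  have hsub : {ω | t ≤ f ω} ⊆ {ω | ENNReal.ofReal (Real.exp (t - c)) ≤
      ENNReal.ofReal (Real.exp (f ω - c))} := fun ω hω =>
    ENNReal.ofReal_le_ofReal (Real.exp_le_exp.2 (by have : t ≤ f ω := hω; linarith))
  calc μ {ω | t ≤ f ω} = ENNReal.ofReal (Real.exp (c - t)) *
        (ENNReal.ofReal (Real.exp (t - c)) * μ {ω | t ≤ f ω}) := by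
        rw [← mul_assoc, ← ENNReal.ofReal_mul (Real.exp_pos _).le, ← Real.exp_add]
        simp
    _ ≤ ENNReal.ofReal (Real.exp (c - t)) * 1 := by
        gcongr
        exact (mul_le_mul_right (measure_mono hsub) _).trans h1
    _ = _ := mul_one _

theorem add_of_indepFun [IsProbabilityMeasure μ] {f g : Ω → ℝ} {c d : ℝ} (hf : ExpBdd μ f c)
    (hg : ExpBdd μ g d) (hfm : Measurable f) (hgm : Measurable g) (hind : IndepFun f g μ) :
    ExpBdd μ (fun ω => f ω + g ω) (c + d) := by
  have hF : Measurable fun x : ℝ => ENNReal.ofReal (Real.exp (x - c)) := by fun_prop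
  have hG : Measurable fun x : ℝ => ENNReal.ofReal (Real.exp (x - d)) := by fun_prop
  have h := lintegral_mul_eq_lintegral_mul_lintegral_of_indepFun (hF.comp hfm) (hG.comp hgm)
    (hind.comp hF hG)
  have h2 : ∀ ω, ENNReal.ofReal (Real.exp (f ω + g ω - (c + d))) =
      (((fun x : ℝ => ENNReal.ofReal (Real.exp (x - c))) ∘ f) *
        ((fun x : ℝ => ENNReal.ofReal (Real.exp (x - d))) ∘ g)) ω := fun ω => by
    simp only [Pi.mul_apply, Function.comp]
    rw [← ENNReal.ofReal_mul (Real.exp_pos _).le, ← Real.exp_add]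
    ring_nf
  unfold ExpBdd
  simp_rw [h2]
  rw [h]
  exact mul_le_one' hf hg

theorem sum_of_iIndepFun [IsProbabilityMeasure μ] {ι : Type*} {f : ι → Ω → ℝ} {c : ι → ℝ}
    (hf : ∀ i, ExpBdd μ (f i) (c i)) (hfm : ∀ i, Measurable (f i)) (hind : iIndepFun f μ)
    (s : Finset ι) : ExpBdd μ (fun ω => ∑ i ∈ s, f i ω) (∑ i ∈ s, c i) := by
  classical
  induction s using Finset.induction_on with
  | empty => simpa using const (μ := μ) (le_refl (0 : ℝ))
  | insert i s hi ih =>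
    simp_rw [Finset.sum_insert hi]
    refine (hf i).add_of_indepFun ih (hfm i) (by fun_prop) ?_
    have := (hind.indepFun_finsetSum_of_notMem hfm hi).symm
    convert this using 2
    simp

/-- The exponential moment of the absolute value of a random variable. -/
theorem abs_of_neg {f : Ω → ℝ} {c : ℝ} (hf : ExpBdd μ f c) (hfn : ExpBdd μ (fun ω => -f ω) c)
    (hfm : Measurable f) : ExpBdd μ (fun ω => |f ω|) (c + Real.log 2) := by
  have key : ∀ ω, ENNReal.ofReal (Real.exp (|f ω| - (c + Real.log 2))) ≤
      2⁻¹ * (ENNReal.ofReal (Real.exp (f ω - c)) + ENNReal.ofReal (Real.exp (-f ω - c))) := by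
    intro ω
    have h2 : (2⁻¹ : ENNReal) = ENNReal.ofReal 2⁻¹ := by
      rw [ENNReal.ofReal_inv_of_pos two_pos]; simp
    rw [h2, ← ENNReal.ofReal_add (Real.exp_pos _).le (Real.exp_pos _).le,
      ← ENNReal.ofReal_mul (by norm_num)]
    refine ENNReal.ofReal_le_ofReal ?_
    have : |f ω| - (c + Real.log 2) = (|f ω| - c) - Real.log 2 := by ring
    rw [this, Real.exp_sub, Real.exp_log two_pos]
    rcases abs_cases (f ω) with ⟨h, _⟩ | ⟨h, _⟩ <;> rw [h] <;>
      nlinarith [Real.exp_pos (f ω - c), Real.exp_pos (-f ω - c)]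
  refine (lintegral_mono key).trans ?_
  rw [lintegral_const_mul' _ _ (by simp), lintegral_add_left (by fun_prop)]
  calc _ ≤ (2⁻¹ : ENNReal) * (1 + 1) := by gcongr <;> assumption
    _ = 1 := by rw [one_add_one_eq_two]; exact ENNReal.inv_mul_cancel (by simp) (by simp)

end ExpBdd

/-- Fubini for independent variables: `S` may be frozen while `X` is integrated out. -/
theorem lintegral_comp_of_indepFun {Ω E F : Type*} [MeasurableSpace Ω] [MeasurableSpace E]
    [MeasurableSpace F] {μ : Measure Ω} [IsProbabilityMeasure μ] {S : Ω → E} {X : Ω → F}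
    (hS : Measurable S) (hX : Measurable X) (hind : IndepFun S X μ) {f : E → F → ENNReal}
    (hf : Measurable (Function.uncurry f)) :
    ∫⁻ ω, f (S ω) (X ω) ∂μ = ∫⁻ ω, ∫⁻ ω', f (S ω) (X ω') ∂μ ∂μ := by
  have h := (indepFun_iff_map_prod_eq_prod_map_map hS.aemeasurable hX.aemeasurable).1 hind
  have := Measure.isProbabilityMeasure_map (μ := μ) hX.aemeasurable
  calc ∫⁻ ω, f (S ω) (X ω) ∂μ
      = ∫⁻ z, Function.uncurry f z ∂(μ.map fun ω => (S ω, X ω)) := by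
        rw [lintegral_map hf (hS.prodMk hX)]; rfl
    _ = ∫⁻ x, ∫⁻ y, f x y ∂(μ.map X) ∂(μ.map S) := by
        rw [h, lintegral_prod _ hf.aemeasurable]; rfl
    _ = ∫⁻ ω, ∫⁻ y, f (S ω) y ∂(μ.map X) ∂μ := by
        rw [lintegral_map hf.lintegral_prod_right hS]
    _ = _ := by
        congr 1
        ext ω
        exact lintegral_map (hf.comp measurable_prodMk_left) hX

/-! ### Exponential moments of quadratic forms in independent variables. -/

section Quadratic

variable {E : Type*} [NormedAddCommGroup E] [InnerProductSpace ℝ E]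

/-- The rank one update `Q + (Qv)(Qv)ᵀ / 2`. -/
noncomputable def rankOneUpdate (Q : E →L[ℝ] E) (v : E) : E →L[ℝ] E :=
  Q + (2⁻¹ : ℝ) • (innerSL ℝ (Q v)).smulRight (Q v)

theorem rankOneUpdate_apply (Q : E →L[ℝ] E) (v u : E) :
    rankOneUpdate Q v u = Q u + (2⁻¹ * (inner ℝ (Q v) u)) • Q v := by
  simp [rankOneUpdate, smul_smul]

/-- `Q` is symmetric and `Q⁻¹ ≥ 1 - ∑ i ∈ t, v i (v i)ᵀ / 2`, written without inverses. -/
def InvGe {ι : Type*} (v : ι → E) (t : Finset ι) (Q : E →L[ℝ] E) : Prop :=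
  (∀ u w, (inner ℝ (Q u) w) = (inner ℝ u (Q w))) ∧
    ∀ u, ‖Q u‖ ^ 2 - 2⁻¹ * ∑ i ∈ t, (inner ℝ (v i) (Q u)) ^ 2 ≤ (inner ℝ (Q u) u)

variable {ι : Type*} {v : ι → E}

theorem InvGe.inner_rankOneUpdate {t : Finset ι} {Q : E →L[ℝ] E} (h : InvGe v t Q) (w u : E) :
    (inner ℝ (rankOneUpdate Q w u) u) = (inner ℝ (Q u) u) + 2⁻¹ * (inner ℝ (Q u) w) ^ 2 := by
  rw [rankOneUpdate_apply, inner_add_left, real_inner_smul_left, h.1 w u,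
    real_inner_comm (Q u) w]
  ring

/-- Formally `Q⁻¹ ≥ 1/2`, since the subtracted sum is at most half the identity; hence `Q² ≤ 2Q`,
which also makes `Q` positive and at most `2`. -/
theorem InvGe.norm_sq_le {t : Finset ι} {Q : E →L[ℝ] E} (h : InvGe v t Q)
    (hv : ∀ y, ∑ i ∈ t, (inner ℝ (v i) y) ^ 2 ≤ ‖y‖ ^ 2) (u : E) : ‖Q u‖ ^ 2 ≤ 2 * (inner ℝ (Q u) u) := by
  linarith [h.2 u, hv (Q u)]

theorem InvGe.inner_le {t : Finset ι} {Q : E →L[ℝ] E} (h : InvGe v t Q)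
    (hv : ∀ y, ∑ i ∈ t, (inner ℝ (v i) y) ^ 2 ≤ ‖y‖ ^ 2) (u : E) : (inner ℝ (Q u) u) ≤ 2 * ‖u‖ ^ 2 := by
  have h1 := h.norm_sq_le hv u
  have h2 := real_inner_le_norm (Q u) u
  nlinarith [sq_nonneg (‖Q u‖ - 2 * ‖u‖), norm_nonneg (Q u), norm_nonneg u]

/-- By Sherman–Morrison the inverse of the update is `Q⁻¹ - (v vᵀ / 2) / (1 + β / 2)` with `β = ⟨Qv,
v⟩ ≥ 0`, which is at least `Q⁻¹ - v vᵀ / 2`. Without inverses: the updated form sends `u` to `Q z`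
for a shifted vector `z`, and the hypothesis is applied at `z`. -/
theorem InvGe.update [DecidableEq ι] {t : Finset ι} {Q : E →L[ℝ] E} (h : InvGe v t Q)
    (hv : ∀ y, ∑ i ∈ t, (inner ℝ (v i) y) ^ 2 ≤ ‖y‖ ^ 2) {i : ι} (hi : i ∉ t) :
    InvGe v (insert i t) (rankOneUpdate Q (v i)) := by
  refine ⟨fun u w => ?_, fun u => ?_⟩
  · rw [rankOneUpdate_apply, rankOneUpdate_apply, inner_add_left, inner_add_right,
      real_inner_smul_left, real_inner_smul_right, h.1 u w, real_inner_comm u (Q (v i))]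
    ring
  · rw [h.inner_rankOneUpdate, Finset.sum_insert hi]
    set α := (inner ℝ (Q u) (v i)) with hα
    set z := u + (2⁻¹ * α) • v i with hz
    have hQ : rankOneUpdate Q (v i) u = Q z := by
      rw [rankOneUpdate_apply, hz, map_add, map_smul, h.1 (v i) u, real_inner_comm]
    have hβ : 0 ≤ (inner ℝ (Q (v i)) (v i)) := by nlinarith [h.norm_sq_le hv (v i), sq_nonneg ‖Q (v i)‖]
    have h1 : (inner ℝ (v i) (Q z)) = α + 2⁻¹ * α * (inner ℝ (Q (v i)) (v i)) := by
      rw [hz, map_add, map_smul, inner_add_right, real_inner_smul_right,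
        real_inner_comm (Q u), real_inner_comm (Q (v i))]
    have h2 : (inner ℝ (Q z) z) = (inner ℝ (Q u) u) + α ^ 2 + 4⁻¹ * α ^ 2 * (inner ℝ (Q (v i)) (v i)) := by
      have h3 : (inner ℝ (Q (v i)) u) = α := by rw [h.1, real_inner_comm]
      rw [hz, map_add, map_smul]
      simp only [inner_add_left, inner_add_right, real_inner_smul_left, real_inner_smul_right, h3]
      rw [← hα]
      ring
    have h4 := h.2 z
    rw [hQ, h1]
    rw [h2] at h4
    nlinarith [mul_nonneg (sq_nonneg α) hβ, mul_nonneg (sq_nonneg α) (sq_nonneg (inner ℝ (Q (v i)) (v i)))]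

variable [MeasurableSpace E] [BorelSpace E] [SecondCountableTopology E]
  {Ω : Type*} [MeasurableSpace Ω] {μ : Measure Ω} [IsProbabilityMeasure μ]

/-- A bound for the exponential moment of a quadratic form in independent variables, of which
some have already been integrated out. -/
theorem expBdd_inner_sum [DecidableEq ι] {X : ι → Ω → ℝ} {l q r : ℝ} (hl : 0 ≤ l) (hr : 0 ≤ r)
    (hq : l * q ≤ 1 / 16) (hX : ∀ i, Measurable (X i)) (hind : iIndepFun X μ)
    (hsub : ∀ i t, ExpBdd μ (fun ω => t * X i ω) (q * t ^ 2))
    (hsq : ∀ i, ExpBdd μ (fun ω => 4 * l * X i ω ^ 2) (l * r))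
    (s : Finset ι) : ∀ t : Finset ι, Disjoint s t →
    (∀ y, ∑ i ∈ s ∪ t, (inner ℝ (v i) y) ^ 2 ≤ ‖y‖ ^ 2) → ∀ Q : E →L[ℝ] E, InvGe v t Q →
    ExpBdd μ (fun ω => l * (inner ℝ (Q (∑ i ∈ s, X i ω • v i)) (∑ i ∈ s, X i ω • v i)))
      (l * r * ∑ i ∈ s, ‖v i‖ ^ 2) := by
  induction s using Finset.induction_on with
  | empty => intro t _ _ Q _; simpa using ExpBdd.const (μ := μ) (le_refl (0 : ℝ))
  | insert i s hi ih =>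
    intro t hst hv Q hQ
    have hit : i ∉ t := Finset.disjoint_left.1 hst (Finset.mem_insert_self i s)
    have hst' : Disjoint s (insert i t) := by
      rw [Finset.disjoint_insert_right]
      exact ⟨hi, hst.mono_left (Finset.subset_insert i s)⟩
    have hun : insert i s ∪ t = s ∪ insert i t := by simp
    have hvt : ∀ y, ∑ k ∈ t, (inner ℝ (v k) y) ^ 2 ≤ ‖y‖ ^ 2 := fun y =>
      (Finset.sum_le_sum_of_subset_of_nonneg Finset.subset_union_right
        fun _ _ _ => sq_nonneg _).trans (hv y)
    have hvi : ‖v i‖ ^ 2 ≤ 1 := by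
      have h1 := (Finset.single_le_sum (f := fun k => (inner ℝ (v k) (v i)) ^ 2)
        (fun _ _ => sq_nonneg _) (Finset.mem_union_left t (Finset.mem_insert_self i s))).trans
        (hv (v i))
      simp only [real_inner_self_eq_norm_sq] at h1
      by_contra hc
      nlinarith
    have hβ0 : 0 ≤ (inner ℝ (Q (v i)) (v i)) := by nlinarith [hQ.norm_sq_le hvt (v i), sq_nonneg ‖Q (v i)‖]
    have hβ := hQ.inner_le hvt (v i)
    have IH := ih (insert i t) hst' (hun ▸ hv) _ (hQ.update hvt hit)
    have hS : Measurable fun ω => ∑ k ∈ s, X k ω • v k :=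
      Finset.measurable_sum _ fun k _ => (hX k).smul_const _
    have hindS : IndepFun (fun ω => ∑ k ∈ s, X k ω • v k) (X i) μ := by
      have h := hind.indepFun_finset s {i} (Finset.disjoint_singleton_right.2 hi) hX
      have hφ : Measurable fun x : s → ℝ => ∑ k, x k • v k :=
        Finset.measurable_sum _ fun k _ => (measurable_pi_apply k).smul_const _
      have hψ : Measurable fun x : ({i} : Finset ι) → ℝ => x ⟨i, Finset.mem_singleton_self i⟩ :=
        measurable_pi_apply _
      have := h.comp hφ hψ
      have h8 : (fun ω => ∑ k ∈ s, X k ω • v k) =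
          (fun x : s → ℝ => ∑ k, x k • v k) ∘ fun ω (k : s) => X k ω :=
        funext fun ω => (Finset.sum_coe_sort s fun k => X k ω • v k).symm
      rw [h8]
      exact this
    have hinner : ∀ σ : E, ExpBdd μ
        (fun ω => l * (inner ℝ (Q (X i ω • v i + σ)) (X i ω • v i + σ)))
        (l * (inner ℝ (rankOneUpdate Q (v i) σ) σ) + l * r * ‖v i‖ ^ 2) := by
      intro σ
      -- With `α = ⟨Qσ, v⟩` and `β = ⟨Qv, v⟩ ≤ 2`, the new terms in the exponent are `2lαx + lβx²`.
      -- Hölder with equal weights separates them. The linear one costs `8ql²α² ≤ lα²/2`, exactly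
      -- the rank one update; the quadratic one is `β/2 ≤ 1` times `4lx²`, so Jensen applies.
      have e1 := (hsub i (4 * l * (inner ℝ (Q σ) (v i)))).convex_comb
        ((hsq i).smul_of_le_one (by fun_prop) (s := (inner ℝ (Q (v i)) (v i)) / 2) (by linarith)
          (by linarith)) (by fun_prop) (s := 1 / 2) (t := 1 / 2) (by norm_num) (by norm_num)
          (by norm_num)
      refine e1.mono fun ω => ?_
      rw [hQ.inner_rankOneUpdate]
      have h3 : (inner ℝ (Q (v i)) σ) = (inner ℝ (Q σ) (v i)) := by rw [hQ.1, real_inner_comm]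
      simp only [map_add, map_smul, inner_add_left, inner_add_right, real_inner_smul_left,
        real_inner_smul_right, h3]
      set α := (inner ℝ (Q σ) (v i))
      have h4 : l * q * (l * α ^ 2) ≤ 1 / 16 * (l * α ^ 2) :=
        mul_le_mul_of_nonneg_right hq (by positivity)
      have h5 : l * r * (inner ℝ (Q (v i)) (v i)) ≤ l * r * (2 * ‖v i‖ ^ 2) :=
        mul_le_mul_of_nonneg_left hβ (by positivity)
      have h6 : 0 ≤ l * r * ‖v i‖ ^ 2 := by positivity
      nlinarith
    unfold ExpBdd at IH ⊢
    simp_rw [Finset.sum_insert hi]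
    have hmeas : Measurable (Function.uncurry fun (σ : E) (x : ℝ) =>
        ENNReal.ofReal (Real.exp (l * (inner ℝ (Q (x • v i + σ)) (x • v i + σ)) -
          l * r * (‖v i‖ ^ 2 + ∑ k ∈ s, ‖v k‖ ^ 2)))) := by
      refine ENNReal.measurable_ofReal.comp (Continuous.measurable ?_)
      fun_prop
    rw [lintegral_comp_of_indepFun hS (hX i) hindS hmeas]
    refine (lintegral_mono fun ω => ?_).trans IH
    have h7 := ExpBdd.iff_lintegral_le.1 ((hinner (∑ k ∈ s, X k ω • v k)).mono
      (c := l * (inner ℝ (rankOneUpdate Q (v i) (∑ k ∈ s, X k ω • v k)) (∑ k ∈ s, X k ω • v k)) -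
        l * r * ∑ k ∈ s, ‖v k‖ ^ 2) (f := fun ω' => l * (inner ℝ (Q (X i ω' • v i +
          (∑ k ∈ s, X k ω • v k))) (X i ω' • v i + (∑ k ∈ s, X k ω • v k))) -
            l * r * (‖v i‖ ^ 2 + ∑ k ∈ s, ‖v k‖ ^ 2)) fun ω' => by
              linarith)
    exact h7

/-- If `∑ i, v i (v i)ᵀ ≤ 1`, then the exponential moment of `‖∑ i, X i • v i‖ ^ 2` is controlled
by the exponential moments of the `(X i) ^ 2`. -/
theorem expBdd_norm_sum_sq [Fintype ι] {X : ι → Ω → ℝ} {l q r : ℝ} (hl : 0 ≤ l) (hr : 0 ≤ r)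
    (hq : l * q ≤ 1 / 16) (hX : ∀ i, Measurable (X i)) (hind : iIndepFun X μ)
    (hsub : ∀ i t, ExpBdd μ (fun ω => t * X i ω) (q * t ^ 2))
    (hsq : ∀ i, ExpBdd μ (fun ω => 4 * l * X i ω ^ 2) (l * r))
    (hv : ∀ y, ∑ i, (inner ℝ (v i) y) ^ 2 ≤ ‖y‖ ^ 2) :
    ExpBdd μ (fun ω => l * ‖∑ i, X i ω • v i‖ ^ 2) (l * r * ∑ i, ‖v i‖ ^ 2) := by
  classical
  have h := expBdd_inner_sum (v := v) hl hr hq hX hind hsub hsq Finset.univ ∅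
    (Finset.disjoint_empty_right _) (by simpa using hv) (ContinuousLinearMap.id ℝ E)
    ⟨fun _ _ => rfl, fun u => by simp⟩
  simpa only [ContinuousLinearMap.id_apply, real_inner_self_eq_norm_sq] using h

end Quadratic

/-! ### Exponential moments of squares by Gaussian linearization. -/

theorem lintegral_exp_mul_gaussianReal (s : ℝ) :
    ∫⁻ g, ENNReal.ofReal (Real.exp (s * g)) ∂(gaussianReal 0 1) =
      ENNReal.ofReal (Real.exp (s ^ 2 / 2)) := by
  rw [← ofReal_integral_eq_lintegral_ofReal (integrable_exp_mul_gaussianReal s)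
    (Filter.Eventually.of_forall fun _ => (Real.exp_pos _).le)]
  have h := mgf_gaussianReal (p := gaussianReal 0 1) (X := id) (μ := 0) (v := 1)
    (by simp) s
  simp only [mgf, id] at h
  rw [h]
  simp

theorem lintegral_exp_sq_gaussianReal :
    ∫⁻ g, ENNReal.ofReal (Real.exp (g ^ 2 / 4)) ∂(gaussianReal 0 1) ≤ 2 := by
  rw [gaussianReal_of_var_ne_zero 0 one_ne_zero,
    lintegral_withDensity_eq_lintegral_mul _ (measurable_gaussianPDF 0 1) (by fun_prop)]
  have h1 : ∀ g : ℝ, (gaussianPDF 0 1 * fun g => ENNReal.ofReal (Real.exp (g ^ 2 / 4))) g =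
      ENNReal.ofReal ((√(2 * Real.pi))⁻¹ * Real.exp (-(1 / 4) * g ^ 2)) := fun g => by
    rw [Pi.mul_apply, gaussianPDF, ← ENNReal.ofReal_mul (gaussianPDFReal_nonneg _ _ _)]
    simp only [gaussianPDFReal, NNReal.coe_one, mul_one, sub_zero]
    rw [mul_assoc, ← Real.exp_add]
    ring_nf
  simp_rw [h1]
  rw [← ofReal_integral_eq_lintegral_ofReal
    ((integrable_exp_neg_mul_sq (by norm_num)).const_mul _)
    (Filter.Eventually.of_forall fun _ => by positivity), integral_const_mul, integral_gaussian]
  rw [show (2 : ENNReal) = ENNReal.ofReal 2 by simp]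
  refine ENNReal.ofReal_le_ofReal ?_
  rw [← Real.sqrt_inv, ← Real.sqrt_mul (by positivity), Real.sqrt_le_left (by norm_num)]
  have := Real.pi_pos
  field_simp
  norm_num

/-- The factor `g²` is absorbed by `exp (g²/8)` and the linear exponent by `exp (1 + g²/16)`; the
exponents add up to `1/4`, still integrable against the Gaussian density. -/
theorem sq_mul_exp_le (g c : ℝ) (hc1 : c ≤ 1 / 8) :
    g ^ 2 * Real.exp (|g| * c) * Real.exp (g ^ 2 / 16) ≤ 24 * Real.exp (g ^ 2 / 4) := by
  have h1 : g ^ 2 ≤ 8 * Real.exp (g ^ 2 / 8) := by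
    nlinarith [Real.add_one_le_exp (g ^ 2 / 8)]
  have h2 : |g| * c ≤ 1 + g ^ 2 / 16 := by
    have h0 := abs_nonneg g
    nlinarith [sq_abs g, sq_nonneg (|g| - 1), mul_le_mul_of_nonneg_left hc1 h0]
  have he : Real.exp 1 ≤ 3 := by linarith [Real.exp_one_lt_d9]
  calc g ^ 2 * Real.exp (|g| * c) * Real.exp (g ^ 2 / 16)
      ≤ 8 * Real.exp (g ^ 2 / 8) * Real.exp (1 + g ^ 2 / 16) * Real.exp (g ^ 2 / 16) := by
        gcongr
    _ = 8 * Real.exp 1 * Real.exp (g ^ 2 / 4) := by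
        rw [Real.exp_add, show g ^ 2 / 4 = g ^ 2 / 8 + g ^ 2 / 16 + g ^ 2 / 16 by ring,
          Real.exp_add, Real.exp_add]
        ring
    _ ≤ _ := by
        have := Real.exp_pos (g ^ 2 / 4)
        nlinarith

/-- The exponential moment of the square of a random variable `X` whose moment generating function
is bounded both by a Gaussian one and by a Bernstein type one. -/
theorem expBdd_sq_of_mgf {Ω : Type*} [MeasurableSpace Ω] {μ : Measure Ω} [IsProbabilityMeasure μ]
    {X : Ω → ℝ} (hX : Measurable X) {l q q' b : ℝ} (hl : 0 ≤ l) (hq : 0 ≤ q)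
    (hlq : 8 * l * q' ≤ 1 / 16) (hlb : 8 * l * b ^ 2 ≤ 1 / 64)
    (hsub : ∀ t, ExpBdd μ (fun ω => t * X ω) (q' * t ^ 2))
    (hmgf : ∀ t, ExpBdd μ (fun ω => t * X ω) (q * t ^ 2 * Real.exp (|t| * b) / 2)) :
    ExpBdd μ (fun ω => 4 * l * X ω ^ 2) (l * (192 * q)) := by
  -- Chosen so that `𝔼 exp (s X g) = exp (s² X² / 2) = exp (4 l X²)` for a standard Gaussian `g`.
  -- After exchanging the integrals only the linear exponential moments of `X` are needed.
  set s := √(8 * l) with hs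
  have hs2 : s ^ 2 = 8 * l := Real.sq_sqrt (by positivity)
  have hs0 : 0 ≤ s := Real.sqrt_nonneg _
  have hsb : s * b ≤ 1 / 8 := by
    refine le_of_sq_le_sq ?_ (by norm_num)
    rw [mul_pow, hs2]
    linarith
  rw [ExpBdd.iff_lintegral_le]
  have h1 : ∀ ω, ENNReal.ofReal (Real.exp (4 * l * X ω ^ 2)) =
      ∫⁻ g, ENNReal.ofReal (Real.exp (s * X ω * g)) ∂(gaussianReal 0 1) := fun ω => by
    rw [lintegral_exp_mul_gaussianReal, mul_pow, hs2]
    ring_nf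
  simp_rw [h1]
  rw [lintegral_lintegral_swap (by
    apply Measurable.aemeasurable
    unfold Function.uncurry
    fun_prop)]
  have h2 : ∀ g : ℝ, ∫⁻ ω, ENNReal.ofReal (Real.exp (s * X ω * g)) ∂μ ≤
      1 + ENNReal.ofReal (96 * l * q) * ENNReal.ofReal (Real.exp (g ^ 2 / 4)) := by
    intro g
    have e : ∀ ω, s * X ω * g = s * g * X ω := fun ω => by ring
    simp_rw [e]
    have a1 := ExpBdd.iff_lintegral_le.1 (hsub (s * g))
    have a2 := ExpBdd.iff_lintegral_le.1 (hmgf (s * g))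
    set A := q * (s * g) ^ 2 * Real.exp (|s * g| * b) / 2 with hA
    have hA0 : 0 ≤ A := by positivity
    have hB : q' * (s * g) ^ 2 ≤ g ^ 2 / 16 := by
      rw [mul_pow, hs2]
      nlinarith [sq_nonneg g]
    -- Both bounds are used at once: the Bernstein exponent `A` gives the first-order size, and the
    -- Gaussian exponent controls the remaining factor `exp M` in `exp M ≤ 1 + M exp M`.
    have a3 : Real.exp (min A (q' * (s * g) ^ 2)) ≤ 1 + A * Real.exp (g ^ 2 / 16) := by
      set M := min A (q' * (s * g) ^ 2)
      have hMA : M ≤ A := min_le_left _ _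
      have hMB : M ≤ g ^ 2 / 16 := (min_le_right _ _).trans hB
      have h3 : Real.exp M * (1 - M) ≤ 1 := by
        have h4 := Real.add_one_le_exp (-M)
        calc Real.exp M * (1 - M) ≤ Real.exp M * Real.exp (-M) :=
              mul_le_mul_of_nonneg_left (by linarith) (Real.exp_pos _).le
          _ = 1 := by rw [← Real.exp_add]; simp
      have h5 : Real.exp M * M ≤ A * Real.exp (g ^ 2 / 16) := by
        calc Real.exp M * M ≤ Real.exp M * A :=
              mul_le_mul_of_nonneg_left hMA (Real.exp_pos _).le
          _ ≤ Real.exp (g ^ 2 / 16) * A :=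
              mul_le_mul_of_nonneg_right (Real.exp_le_exp.2 hMB) hA0
          _ = _ := mul_comm _ _
      linarith
    have a4 : A * Real.exp (g ^ 2 / 16) ≤ 96 * l * q * Real.exp (g ^ 2 / 4) := by
      have h6 := sq_mul_exp_le g (s * b) hsb
      have h7 : |s * g| * b = |g| * (s * b) := by rw [abs_mul, abs_of_nonneg hs0]; ring
      rw [hA, h7, mul_pow, hs2]
      have h8 := mul_le_mul_of_nonneg_left h6 (show 0 ≤ 4 * l * q by positivity)
      nlinarith
    calc ∫⁻ ω, ENNReal.ofReal (Real.exp (s * g * X ω)) ∂μ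
        ≤ ENNReal.ofReal (Real.exp (min A (q' * (s * g) ^ 2))) := by
          rcases min_choice A (q' * (s * g) ^ 2) with h | h <;> rw [h] <;> assumption
      _ ≤ ENNReal.ofReal (1 + 96 * l * q * Real.exp (g ^ 2 / 4)) :=
          ENNReal.ofReal_le_ofReal (by linarith)
      _ = _ := by
          rw [ENNReal.ofReal_add zero_le_one (by positivity), ENNReal.ofReal_one,
            ENNReal.ofReal_mul (by positivity)]
  refine (lintegral_mono h2).trans ?_
  rw [lintegral_add_left measurable_const, lintegral_const_mul' _ _ ENNReal.ofReal_ne_top,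
    lintegral_const, measure_univ, mul_one]
  calc (1 : ENNReal) + ENNReal.ofReal (96 * l * q) *
        ∫⁻ g, ENNReal.ofReal (Real.exp (g ^ 2 / 4)) ∂(gaussianReal 0 1)
      ≤ 1 + ENNReal.ofReal (96 * l * q) * 2 := by
        gcongr
        exact lintegral_exp_sq_gaussianReal
    _ = ENNReal.ofReal (1 + 96 * l * q * 2) := by
        rw [ENNReal.ofReal_add zero_le_one (by positivity), ENNReal.ofReal_one,
          ENNReal.ofReal_mul (by positivity : 0 ≤ 96 * l * q)]
        simp only [ENNReal.ofReal_ofNat]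
    _ ≤ _ := ENNReal.ofReal_le_ofReal (by linarith [Real.add_one_le_exp (l * (192 * q))])

/-- If the entries of an array are independent, then so are its rows. -/
theorem ProbabilityTheory.iIndepFun.rows {Ω ι κ : Type*} [Fintype ι] [Fintype κ]
    [MeasurableSpace Ω] {μ : Measure Ω} {a : ι → κ → Ω → ℝ} (ha : ∀ i j, Measurable (a i j))
    (hind : iIndepFun (fun ij : ι × κ => a ij.1 ij.2) μ) :
    iIndepFun (fun i ω j => a i j ω) μ := by
  have := hind.isProbabilityMeasure
  have hσ : iIndepFun (fun p : (_ : ι) × κ => a p.1 p.2) μ :=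
    hind.precomp (Equiv.sigmaEquivProd ι κ).injective
  have : ∀ i j, IsProbabilityMeasure (μ.map (a i j)) :=
    fun i j => Measure.isProbabilityMeasure_map (ha i j).aemeasurable
  have hrow : ∀ i, μ.map (fun ω j => a i j ω) = Measure.infinitePi fun j => μ.map (a i j) :=
    fun i => (iIndepFun_iff_map_fun_eq_infinitePi_map (ha i)).1
      (hind.precomp (g := fun j => (i, j)) (Prod.mk_right_injective i))
  have hcurry : (MeasurableEquiv.piCurry fun (_ : ι) (_ : κ) => ℝ) ∘
      (fun ω (p : (_ : ι) × κ) => a p.1 p.2 ω) = fun ω i j => a i j ω := by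
    ext; simp [Sigma.curry]
  rw [iIndepFun_iff_map_fun_eq_infinitePi_map (by fun_prop)]
  simp_rw [hrow]
  rw [← Measure.infinitePi_map_piCurry (fun i j => μ.map (a i j)),
    ← (iIndepFun_iff_map_fun_eq_infinitePi_map (by fun_prop)).1 hσ,
    Measure.map_map (by fun_prop) (by fun_prop), hcurry]

/-! ### Moment generating functions of symmetric variables. -/

/-- From `cosh t - 1 = 2 sinh² (t/2)` and `sinh s ≤ s exp s` for `s ≥ 0`. -/
theorem Real.cosh_sub_one_le (t : ℝ) : Real.cosh t - 1 ≤ t ^ 2 * Real.exp |t| / 2 := by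
  have h1 : Real.cosh t - 1 = 2 * Real.sinh (t / 2) ^ 2 := by
    have := Real.cosh_two_mul (t / 2)
    have h2 := Real.cosh_sq (t / 2)
    rw [show 2 * (t / 2) = t by ring] at this
    linarith
  have h2 : |Real.sinh (t / 2)| ≤ |t| / 2 * Real.exp (|t| / 2) := by
    rw [Real.abs_sinh, abs_div, abs_two, Real.sinh_eq]
    set s := |t| / 2
    have hs : 0 ≤ s := by positivity
    have h3 : Real.exp s * (1 - 2 * s) ≤ Real.exp (-s) := by
      have h4 := Real.add_one_le_exp (-(2 * s))
      calc Real.exp s * (1 - 2 * s) ≤ Real.exp s * Real.exp (-(2 * s)) :=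
            mul_le_mul_of_nonneg_left (by linarith) (Real.exp_pos _).le
        _ = _ := by rw [← Real.exp_add]; ring_nf
    linarith
  have h3 : Real.sinh (t / 2) ^ 2 ≤ (|t| / 2 * Real.exp (|t| / 2)) ^ 2 := by
    rw [← sq_abs (Real.sinh (t / 2))]
    exact pow_le_pow_left₀ (abs_nonneg _) h2 2
  have h4 : (|t| / 2 * Real.exp (|t| / 2)) ^ 2 = t ^ 2 * Real.exp |t| / 4 := by
    rw [mul_pow, div_pow, sq_abs, ← Real.exp_nat_mul]
    push_cast
    rw [show 2 * (|t| / 2) = |t| by ring]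
    ring
  rw [h1]
  linarith

/-- Convexity of `exp` between `0` and `±t`. The bound is linear in `|a|`, which is how a first
absolute moment comes to control the exponential moment. -/
theorem Real.cosh_mul_le (t a : ℝ) (ha : |a| ≤ 1) :
    Real.cosh (t * a) ≤ 1 + |a| * (Real.cosh t - 1) := by
  have h1 := convexOn_exp.2 (Set.mem_univ t) (Set.mem_univ 0) (abs_nonneg a)
    (sub_nonneg.2 ha) (by ring)
  have h2 := convexOn_exp.2 (Set.mem_univ (-t)) (Set.mem_univ 0) (abs_nonneg a)
    (sub_nonneg.2 ha) (by ring)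
  simp only [smul_eq_mul, mul_zero, add_zero, Real.exp_zero, mul_one, mul_neg] at h1 h2
  have h3 : Real.cosh (t * a) = Real.cosh (|a| * t) := by
    rcases abs_cases a with ⟨h, _⟩ | ⟨h, _⟩ <;> rw [h]
    · rw [mul_comm]
    · rw [neg_mul, Real.cosh_neg, mul_comm]
  rw [h3, Real.cosh_eq, Real.cosh_eq]
  linarith

section Symm

variable {Ω : Type*} [MeasurableSpace Ω] {μ : Measure Ω} {T : Ω → Ω}

/-- Average the integrals of `exp f` and `exp (f ∘ T) = exp (-f)`. The right side increases with
`|f|`, so pointwise bounds on absolute values transfer to exponential moments. -/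
theorem lintegral_exp_eq_cosh_of_symm (hT : MeasurePreserving T μ μ) {f : Ω → ℝ}
    (hf : Measurable f) (hfT : ∀ ω, f (T ω) = -f ω) :
    ∫⁻ ω, ENNReal.ofReal (Real.exp (f ω)) ∂μ = ∫⁻ ω, ENNReal.ofReal (Real.cosh (f ω)) ∂μ := by
  have h1 : ∫⁻ ω, ENNReal.ofReal (Real.exp (f ω)) ∂μ =
      ∫⁻ ω, ENNReal.ofReal (Real.exp (-f ω)) ∂μ := by
    rw [← hT.lintegral_comp (f := fun ω => ENNReal.ofReal (Real.exp (f ω))) (by fun_prop)]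
    simp_rw [hfT]
  have h2 : ∀ ω, ENNReal.ofReal (Real.cosh (f ω)) =
      2⁻¹ * (ENNReal.ofReal (Real.exp (f ω)) + ENNReal.ofReal (Real.exp (-f ω))) := by
    intro ω
    have h2 : (2⁻¹ : ENNReal) = ENNReal.ofReal 2⁻¹ := by
      rw [ENNReal.ofReal_inv_of_pos two_pos]; simp
    rw [h2, ← ENNReal.ofReal_add (Real.exp_pos _).le (Real.exp_pos _).le,
      ← ENNReal.ofReal_mul (by norm_num), Real.cosh_eq]
    ring_nf
  simp_rw [h2]
  rw [lintegral_const_mul' _ _ (by simp), lintegral_add_left (by fun_prop), ← h1, ← two_mul,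
    ← mul_assoc, ENNReal.inv_mul_cancel (by simp) (by simp), one_mul]

/-- The exponential moments of a symmetric random variable decrease under truncation. -/
theorem ExpBdd.of_abs_le_of_symm (hT : MeasurePreserving T μ μ) {f g : Ω → ℝ} {c : ℝ}
    (hg : ExpBdd μ g c) (hfm : Measurable f) (hgm : Measurable g) (hfT : ∀ ω, f (T ω) = -f ω)
    (hgT : ∀ ω, g (T ω) = -g ω) (hfg : ∀ ω, |f ω| ≤ |g ω|) : ExpBdd μ f c := by
  rw [ExpBdd.iff_lintegral_le, lintegral_exp_eq_cosh_of_symm hT hgm hgT] at hg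
  rw [ExpBdd.iff_lintegral_le, lintegral_exp_eq_cosh_of_symm hT hfm hfT]
  exact (lintegral_mono fun ω => ENNReal.ofReal_le_ofReal (Real.cosh_le_cosh.2 (hfg ω))).trans hg

end Symm

/-- The exponential moment of a random variable below an affine function of a nonnegative variable
with mean at most `q`. -/
theorem lintegral_ofReal_le_of_le_affine {Ω : Type*} [MeasurableSpace Ω] {μ : Measure Ω}
    [IsProbabilityMeasure μ] {f g : Ω → ℝ} {q s : ℝ} (hs : 0 ≤ s) (hq : 0 ≤ q)
    (hg : ∀ ω, 0 ≤ g ω) (hgq : ∫⁻ ω, ENNReal.ofReal (g ω) ∂μ ≤ ENNReal.ofReal q)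
    (hfg : ∀ ω, f ω ≤ 1 + g ω * s) :
    ∫⁻ ω, ENNReal.ofReal (f ω) ∂μ ≤ ENNReal.ofReal (Real.exp (q * s)) := by
  calc ∫⁻ ω, ENNReal.ofReal (f ω) ∂μ
      ≤ ∫⁻ ω, (1 + ENNReal.ofReal (g ω) * ENNReal.ofReal s) ∂μ := by
        refine lintegral_mono fun ω => ?_
        rw [← ENNReal.ofReal_mul (hg ω), ← ENNReal.ofReal_one,
          ← ENNReal.ofReal_add zero_le_one (mul_nonneg (hg ω) hs)]
        exact ENNReal.ofReal_le_ofReal (hfg ω)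
    _ = 1 + (∫⁻ ω, ENNReal.ofReal (g ω) ∂μ) * ENNReal.ofReal s := by
        rw [lintegral_add_left measurable_const, lintegral_mul_const' _ _ ENNReal.ofReal_ne_top]
        simp
    _ ≤ 1 + ENNReal.ofReal q * ENNReal.ofReal s := by gcongr
    _ = ENNReal.ofReal (1 + q * s) := by
        rw [ENNReal.ofReal_add zero_le_one (by positivity), ENNReal.ofReal_one,
          ENNReal.ofReal_mul hq]
    _ ≤ _ := ENNReal.ofReal_le_ofReal (by linarith [Real.add_one_le_exp (q * s)])

/-! ### Sparse symmetric arrays: entries, rows and single vectors. -/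

/-- An array of independent symmetric random variables, bounded by `1` and with first absolute
moments at most `q`. -/
structure SparseFamily {Ω : Type*} [MeasurableSpace Ω] (μ : Measure Ω) {N n : ℕ} (q : ℝ)
    (a : Fin N → Fin n → Ω → ℝ) : Prop where
  meas : ∀ i j, Measurable (a i j)
  indep : iIndepFun (fun ij : Fin N × Fin n => a ij.1 ij.2) μ
  symm : ∃ T : Ω → Ω, MeasurePreserving T μ μ ∧ ∀ i j ω, a i j (T ω) = -a i j ω
  abs_le_one : ∀ i j ω, |a i j ω| ≤ 1
  lintegral_abs_le : ∀ i j, ∫⁻ ω, ENNReal.ofReal |a i j ω| ∂μ ≤ ENNReal.ofReal q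

namespace SparseFamily

variable {Ω : Type*} [MeasurableSpace Ω] {μ : Measure Ω} [IsProbabilityMeasure μ] {N n : ℕ}
  {q : ℝ} {a : Fin N → Fin n → Ω → ℝ}

theorem expBdd_cosh (h : SparseFamily μ q a) (hq : 0 ≤ q) (i : Fin N) (j : Fin n) (t : ℝ) :
    ExpBdd μ (fun ω => t * a i j ω) (q * (Real.cosh t - 1)) := by
  obtain ⟨T, hT, haT⟩ := h.symm
  have hm := h.meas i j
  rw [ExpBdd.iff_lintegral_le, lintegral_exp_eq_cosh_of_symm hT (by fun_prop)
    (fun ω => by rw [haT]; ring)]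
  exact lintegral_ofReal_le_of_le_affine (by linarith [Real.one_le_cosh t]) hq
    (fun ω => abs_nonneg _) (h.lintegral_abs_le i j)
    fun ω => Real.cosh_mul_le t _ (h.abs_le_one i j ω)

theorem expBdd_mul (h : SparseFamily μ q a) (hq : 0 ≤ q) (i : Fin N) (j : Fin n) (t : ℝ) :
    ExpBdd μ (fun ω => t * a i j ω) (q * t ^ 2 * Real.exp |t| / 2) :=
  (h.expBdd_cosh hq i j t).mono_right (by
    have := mul_le_mul_of_nonneg_left (Real.cosh_sub_one_le t) hq
    linarith)

theorem expBdd_mul_gaussian (h : SparseFamily μ q a) (i : Fin N) (j : Fin n) (t : ℝ) :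
    ExpBdd μ (fun ω => t * a i j ω) (1 / 2 * t ^ 2) := by
  rw [ExpBdd.iff_lintegral_le]
  obtain ⟨T, hT, haT⟩ := h.symm
  have hm := h.meas i j
  rw [lintegral_exp_eq_cosh_of_symm hT (by fun_prop) (fun ω => by rw [haT]; ring)]
  calc ∫⁻ ω, ENNReal.ofReal (Real.cosh (t * a i j ω)) ∂μ
      ≤ ∫⁻ _, ENNReal.ofReal (Real.cosh t) ∂μ := by
        refine lintegral_mono fun ω => ENNReal.ofReal_le_ofReal (Real.cosh_le_cosh.2 ?_)
        rw [abs_mul]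
        exact mul_le_of_le_one_right (abs_nonneg t) (h.abs_le_one i j ω)
    _ = ENNReal.ofReal (Real.cosh t) := by simp
    _ ≤ _ := ENNReal.ofReal_le_ofReal ((Real.cosh_le_exp_half_sq t).trans_eq (by ring_nf))

/-- The shape is the one required by `expBdd_norm_sum_sq` with `l = 1/8` and `r = 8q`. The exponent
is at most `|a|/2 ≤ 1/2`, where `exp` is at most `2`, so its exponential is at most `1 + |a|`. -/
theorem expBdd_sq (h : SparseFamily μ q a) (hq : 0 ≤ q) (i : Fin N) (j : Fin n) :
    ExpBdd μ (fun ω => 4 * (1 / 8) * a i j ω ^ 2) (1 / 8 * (8 * q)) := by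
  rw [ExpBdd.iff_lintegral_le]
  refine (lintegral_ofReal_le_of_le_affine zero_le_one hq (fun ω => abs_nonneg (a i j ω))
    (h.lintegral_abs_le i j) fun ω => ?_).trans_eq (by ring_nf)
  have h1 := h.abs_le_one i j ω
  have h0 := abs_nonneg (a i j ω)
  have h2 : a i j ω ^ 2 ≤ |a i j ω| := by rw [← sq_abs]; nlinarith
  set x := 4 * (1 / 8) * a i j ω ^ 2
  have hx : x ≤ |a i j ω| / 2 := by simp only [x]; linarith
  have h3 : Real.exp x * (1 - x) ≤ 1 := by
    have h4 := Real.add_one_le_exp (-x)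
    calc Real.exp x * (1 - x) ≤ Real.exp x * Real.exp (-x) :=
          mul_le_mul_of_nonneg_left (by linarith) (Real.exp_pos _).le
      _ = 1 := by rw [← Real.exp_add]; simp
  have h4 := Real.exp_pos x
  nlinarith

theorem expBdd_abs (h : SparseFamily μ q a) (hq : 0 ≤ q) (i : Fin N) (j : Fin n) :
    ExpBdd μ (fun ω => |a i j ω|) (2 * q) := by
  rw [ExpBdd.iff_lintegral_le]
  refine (lintegral_ofReal_le_of_le_affine zero_le_two hq (fun ω => abs_nonneg (a i j ω))
    (h.lintegral_abs_le i j) fun ω => ?_).trans_eq (by ring_nf)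
  have h1 := h.abs_le_one i j ω
  have h2 := convexOn_exp.2 (Set.mem_univ 1) (Set.mem_univ 0) (abs_nonneg (a i j ω))
    (sub_nonneg.2 h1) (by ring)
  simp only [smul_eq_mul, mul_zero, add_zero, Real.exp_zero, mul_one] at h2
  nlinarith [Real.exp_one_lt_d9, abs_nonneg (a i j ω)]

omit [IsProbabilityMeasure μ] in
theorem indep_row (h : SparseFamily μ q a) (i : Fin N) : iIndepFun (fun j => a i j) μ :=
  h.indep.precomp (g := fun j => (i, j)) (Prod.mk_right_injective i)

theorem expBdd_row_abs (h : SparseFamily μ q a) (hq : 0 ≤ q) (i : Fin N) :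
    ExpBdd μ (fun ω => ∑ j, |a i j ω|) (2 * (n * q)) := by
  have hm := h.meas i
  have := ExpBdd.sum_of_iIndepFun (fun j => h.expBdd_abs hq i j) (fun j => by fun_prop)
    ((h.indep_row i).comp (fun _ x => |x|) fun _ => by fun_prop) Finset.univ
  refine this.mono_right ?_
  simp
  linarith

/-- A Bernstein-type bound with variance proxy `q ∑ uⱼ²`: coordinates bounded by `1` allow `exp |t
uⱼ|` to be replaced by `exp |t|`. -/
theorem expBdd_row_sum (h : SparseFamily μ q a) (hq : 0 ≤ q) (i : Fin N) {u : Fin n → ℝ}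
    (hu : ∀ j, |u j| ≤ 1) (t : ℝ) :
    ExpBdd μ (fun ω => t * ∑ j, u j * a i j ω)
      ((∑ j, u j ^ 2) * q * t ^ 2 * Real.exp |t| / 2) := by
  have hm := h.meas i
  have := ExpBdd.sum_of_iIndepFun (fun j => h.expBdd_mul hq i j (t * u j)) (fun j => by fun_prop)
    ((h.indep_row i).comp (fun j x => t * u j * x) fun _ => by fun_prop) Finset.univ
  have e : ∀ ω, t * ∑ j, u j * a i j ω = ∑ j, t * u j * a i j ω := fun ω => by
    rw [Finset.mul_sum]
    exact Finset.sum_congr rfl fun j _ => by ring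
  simp_rw [e]
  refine this.mono_right ?_
  have h1 : ∀ j, q * (t * u j) ^ 2 * Real.exp |t * u j| / 2 ≤
      u j ^ 2 * (q * t ^ 2 * Real.exp |t| / 2) := fun j => by
    have : |t * u j| ≤ |t| := by
      rw [abs_mul]; exact mul_le_of_le_one_right (abs_nonneg t) (hu j)
    have h2 := mul_le_mul_of_nonneg_left (Real.exp_le_exp.2 this)
      (show 0 ≤ q * (t * u j) ^ 2 by positivity)
    nlinarith
  refine (Finset.sum_le_sum fun j _ => h1 j).trans_eq ?_
  rw [← Finset.sum_mul]
  ring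

variable {E : Type*} [NormedAddCommGroup E] [InnerProductSpace ℝ E] [MeasurableSpace E]
  [BorelSpace E] [SecondCountableTopology E]

/-- The exponential moment of `‖BAx‖ ^ 2` for a fixed vector `x` in the unit ball. -/
theorem expBdd_norm_sq (h : SparseFamily μ q a) (hq : 0 ≤ q) {b : Fin N → E}
    (hb : ∀ y, ∑ i, inner ℝ (b i) y ^ 2 ≤ ‖y‖ ^ 2) (hbn : ∑ i, ‖b i‖ ^ 2 ≤ n) {x : Fin n → ℝ}
    (hx : ∑ j, x j ^ 2 ≤ 1) :
    ExpBdd μ (fun ω => 1 / 8 * ‖∑ i, (∑ j, x j * a i j ω) • b i‖ ^ 2) (n * q) := by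
  have h1 := expBdd_norm_sum_sq (v := fun ij : Fin N × Fin n => x ij.2 • b ij.1) (l := 1 / 8)
    (q := 1 / 2) (r := 8 * q) (by norm_num) (by positivity) (by norm_num)
    (fun ij => h.meas ij.1 ij.2) h.indep (fun ij t => h.expBdd_mul_gaussian ij.1 ij.2 t)
    (fun ij => h.expBdd_sq hq ij.1 ij.2) ?_
  · have e : ∀ ω, ∑ i, (∑ j, x j * a i j ω) • b i =
        ∑ ij : Fin N × Fin n, a ij.1 ij.2 ω • x ij.2 • b ij.1 := fun ω => by
      rw [Fintype.sum_prod_type]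
      refine Finset.sum_congr rfl fun i _ => ?_
      rw [Finset.sum_smul]
      exact Finset.sum_congr rfl fun j _ => by rw [smul_smul, mul_comm]
    simp_rw [e]
    refine h1.mono_right ?_
    have e2 : ∑ ij : Fin N × Fin n, ‖x ij.2 • b ij.1‖ ^ 2 =
        (∑ i, ‖b i‖ ^ 2) * ∑ j, x j ^ 2 := by
      rw [Fintype.sum_prod_type, Finset.sum_mul_sum]
      refine Finset.sum_congr rfl fun i _ => Finset.sum_congr rfl fun j _ => ?_
      rw [norm_smul, mul_pow, Real.norm_eq_abs, sq_abs, mul_comm]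
    rw [e2]
    have h2 : (∑ i, ‖b i‖ ^ 2) * ∑ j, x j ^ 2 ≤ n * 1 :=
      mul_le_mul hbn hx (Finset.sum_nonneg fun _ _ => sq_nonneg _) (by positivity)
    nlinarith
  · intro y
    have e3 : ∑ ij : Fin N × Fin n, inner ℝ (x ij.2 • b ij.1) y ^ 2 =
        (∑ i, inner ℝ (b i) y ^ 2) * ∑ j, x j ^ 2 := by
      rw [Fintype.sum_prod_type, Finset.sum_mul_sum]
      refine Finset.sum_congr rfl fun i _ => Finset.sum_congr rfl fun j _ => ?_
      rw [real_inner_smul_left, mul_pow, mul_comm]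
    rw [e3]
    calc _ ≤ (∑ i, inner ℝ (b i) y ^ 2) * 1 :=
          mul_le_mul_of_nonneg_left hx (Finset.sum_nonneg fun _ _ => sq_nonneg _)
      _ ≤ _ := by rw [mul_one]; exact hb y

end SparseFamily

/-- Duality: `‖S‖² = ∑ cᵢ ⟨bᵢ, S⟩`, and Cauchy–Schwarz gives `‖S‖⁴ ≤ (∑ cᵢ²) ‖S‖²`. -/
theorem norm_sum_smul_sq_le {E ι : Type*} [NormedAddCommGroup E] [InnerProductSpace ℝ E]
    [Fintype ι] {b : ι → E} (hb : ∀ y, ∑ i, inner ℝ (b i) y ^ 2 ≤ ‖y‖ ^ 2) (c : ι → ℝ) :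
    ‖∑ i, c i • b i‖ ^ 2 ≤ ∑ i, c i ^ 2 := by
  set S := ∑ i, c i • b i with hS
  have h1 : ‖S‖ ^ 2 = ∑ i, c i * inner ℝ (b i) S := by
    rw [← real_inner_self_eq_norm_sq]
    conv_lhs => rw [hS]
    rw [sum_inner]
    exact Finset.sum_congr rfl fun i _ => by rw [real_inner_smul_left]
  have h2 := Finset.sum_mul_sq_le_sq_mul_sq Finset.univ c fun i => inner ℝ (b i) S
  rw [← h1] at h2
  have h3 : (∑ i, c i ^ 2) * ∑ i, inner ℝ (b i) S ^ 2 ≤ (∑ i, c i ^ 2) * ‖S‖ ^ 2 :=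
    mul_le_mul_of_nonneg_left (hb S) (Finset.sum_nonneg fun _ _ => sq_nonneg _)
  by_contra hc
  push Not at hc
  have h4 : 0 ≤ ∑ i, c i ^ 2 := Finset.sum_nonneg fun _ _ => sq_nonneg _
  nlinarith

theorem norm_add_sq_le_two_mul {E : Type*} [SeminormedAddCommGroup E] (x y : E) :
    ‖x + y‖ ^ 2 ≤ 2 * ‖x‖ ^ 2 + 2 * ‖y‖ ^ 2 := by
  nlinarith [norm_add_le x y, norm_nonneg (x + y), sq_nonneg (‖x‖ - ‖y‖), norm_nonneg x,
    norm_nonneg y]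

/-- Used with `y = n/m`: the weight `ℓ² exp (ℓ/2)` of the entropy per coordinate is paid for by the
sparsity ratio. The square is absorbed through `1 + z ≤ 4 exp (z/4)`. -/
theorem Real.sq_log_mul_exp_half_le {y : ℝ} (hy : 1 ≤ y) :
    (1 + Real.log y) ^ 2 * Real.exp ((1 + Real.log y) / 2) ≤ 32 * y := by
  have hy0 : 0 < y := by linarith
  set z := Real.log y with hz
  have hz0 : 0 ≤ z := Real.log_nonneg hy
  have h1 : 1 + z ≤ 4 * Real.exp (z / 4) := by linarith [Real.add_one_le_exp (z / 4)]
  have h2 : Real.exp (z / 4) ^ 2 * Real.exp (z / 2) = y := by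
    rw [← Real.exp_nat_mul, ← Real.exp_add]
    push_cast
    rw [show 2 * (z / 4) + z / 2 = z by ring, hz, Real.exp_log hy0]
  have h3 : Real.exp (1 / 2 : ℝ) ≤ 2 := by
    have : Real.exp (1 / 2 : ℝ) ^ 2 = Real.exp 1 := by
      rw [← Real.exp_nat_mul]; norm_num
    nlinarith [Real.exp_one_lt_d9, Real.exp_pos (1 / 2 : ℝ)]
  calc (1 + z) ^ 2 * Real.exp ((1 + z) / 2)
      ≤ (4 * Real.exp (z / 4)) ^ 2 * Real.exp ((1 + z) / 2) := by gcongr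
    _ = 16 * (Real.exp (z / 4) ^ 2 * Real.exp (z / 2)) * Real.exp (1 / 2 : ℝ) := by
        rw [add_div, Real.exp_add]; ring
    _ ≤ 16 * (Real.exp (z / 4) ^ 2 * Real.exp (z / 2)) * 2 := by gcongr
    _ = _ := by rw [h2]; ring

/-! ### Truncated row sums and the tail bound for one vector. -/

/-- Truncation at level `R`. -/
noncomputable def trunc (R x : ℝ) : ℝ := if |x| ≤ R then x else 0

theorem measurable_trunc (R : ℝ) : Measurable (trunc R) :=
  Measurable.ite (measurableSet_le (by fun_prop) measurable_const) measurable_id measurable_const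

theorem trunc_neg (R x : ℝ) : trunc R (-x) = -trunc R x := by
  unfold trunc; split_ifs <;> simp_all

theorem abs_trunc_le_abs (R x : ℝ) : |trunc R x| ≤ |x| := by
  unfold trunc; split_ifs <;> simp

theorem abs_trunc_le {R : ℝ} (hR : 0 ≤ R) (x : ℝ) : |trunc R x| ≤ R := by
  unfold trunc; split_ifs <;> simp_all

/-- A Gaussian bound for the exponential moments of a truncated symmetric random variable. -/
theorem ExpBdd.trunc_gaussian {Ω : Type*} [MeasurableSpace Ω] {μ : Measure Ω}
    [IsProbabilityMeasure μ] {T : Ω → Ω} (hT : MeasurePreserving T μ μ) {X : Ω → ℝ}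
    (hX : Measurable X) (hXT : ∀ ω, X (T ω) = -X ω) {ℓ q' R v : ℝ} (hℓ : 0 < ℓ) (hR : 0 ≤ R)
    (hv : 0 ≤ v) (hmgf : ∀ t, ExpBdd μ (fun ω => t * X ω) (v * t ^ 2 * Real.exp |t| / 2))
    (h1 : v * Real.exp (ℓ / 2) ≤ 2 * q') (h2 : 2 * R ≤ q' * ℓ) (t : ℝ) :
    ExpBdd μ (fun ω => t * trunc R (X ω)) (q' * t ^ 2) := by
  have hm := (measurable_trunc R).comp hX
  simp only [Function.comp_def] at hm
  -- For small `|t|` the Bernstein bound is Gaussian because `exp |t| ≤ exp (ℓ/2)`. For large `|t|`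
  -- boundedness suffices: `|t| R ≤ q' t²`.
  rcases le_total |t| (ℓ / 2) with ht | ht
  · refine ExpBdd.mono_right ((hmgf t).of_abs_le_of_symm hT (by fun_prop) (by fun_prop)
      (fun ω => by rw [hXT, trunc_neg]; ring) (fun ω => by rw [hXT]; ring) fun ω => ?_) ?_
    · rw [abs_mul, abs_mul]
      exact mul_le_mul_of_nonneg_left (abs_trunc_le_abs _ _) (abs_nonneg t)
    · have h3 : v * Real.exp |t| ≤ 2 * q' := (mul_le_mul_of_nonneg_left
        (Real.exp_le_exp.2 ht) hv).trans h1
      nlinarith [sq_nonneg t]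
  · refine (ExpBdd.const (μ := μ) (le_refl (q' * t ^ 2))).mono fun ω => ?_
    have h3 : t * trunc R (X ω) ≤ |t| * R := (le_abs_self _).trans
      (by rw [abs_mul]; exact mul_le_mul_of_nonneg_left (abs_trunc_le hR _) (abs_nonneg t))
    have h4 : |t| * R ≤ q' * t ^ 2 := by
      have hq' : 0 ≤ q' := by
        by_contra hc
        push Not at hc
        nlinarith
      rw [← sq_abs t]
      nlinarith [abs_nonneg t, mul_nonneg (abs_nonneg t) hq', mul_le_mul_of_nonneg_left ht
        (mul_nonneg (abs_nonneg t) hq'), mul_le_mul_of_nonneg_left h2 (abs_nonneg t)]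
    linarith

/-- An exponential moment of the part of a random variable which exceeds a large level. -/
theorem ExpBdd.abs_sub_trunc {Ω : Type*} [MeasurableSpace Ω] {μ : Measure Ω}
    [IsProbabilityMeasure μ] {X : Ω → ℝ} {θ R c ε : ℝ} (hθ : 0 ≤ θ)
    (hX : ExpBdd μ (fun ω => 2 * θ * |X ω|) c) (hc : Real.exp (c - θ * R) ≤ ε) :
    ExpBdd μ (fun ω => θ * |X ω - trunc R (X ω)|) ε := by
  rw [ExpBdd.iff_lintegral_le] at hX ⊢
  calc ∫⁻ ω, ENNReal.ofReal (Real.exp (θ * |X ω - trunc R (X ω)|)) ∂μ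
      ≤ ∫⁻ ω, (1 + ENNReal.ofReal (Real.exp (-(θ * R))) *
          ENNReal.ofReal (Real.exp (2 * θ * |X ω|))) ∂μ := by
        refine lintegral_mono fun ω => ?_
        rw [← ENNReal.ofReal_mul (Real.exp_pos _).le, ← Real.exp_add, ← ENNReal.ofReal_one,
          ← ENNReal.ofReal_add zero_le_one (Real.exp_pos _).le]
        refine ENNReal.ofReal_le_ofReal ?_
        unfold trunc
        split_ifs with h
        · simp [(Real.exp_pos _).le]
        -- Above the level, `θ|X| ≤ 2θ|X| - θR`.
        · rw [sub_zero]
          push Not at h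
          have : Real.exp (θ * |X ω|) ≤ Real.exp (-(θ * R) + 2 * θ * |X ω|) :=
            Real.exp_le_exp.2 (by nlinarith)
          linarith
    _ ≤ 1 + ENNReal.ofReal (Real.exp (-(θ * R))) * ENNReal.ofReal (Real.exp c) := by
        rw [lintegral_add_left measurable_const, lintegral_const_mul' _ _ ENNReal.ofReal_ne_top]
        simp only [lintegral_const, measure_univ, mul_one]
        gcongr
    _ = ENNReal.ofReal (1 + Real.exp (c - θ * R)) := by
        rw [ENNReal.ofReal_add zero_le_one (Real.exp_pos _).le, ENNReal.ofReal_one,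
          ← ENNReal.ofReal_mul (Real.exp_pos _).le, ← Real.exp_add]
        ring_nf
    _ ≤ _ := ENNReal.ofReal_le_ofReal (by linarith [Real.add_one_le_exp ε])

namespace SparseFamily

variable {Ω : Type*} [MeasurableSpace Ω] {μ : Measure Ω} [IsProbabilityMeasure μ] {N n : ℕ}
  {q : ℝ} {a : Fin N → Fin n → Ω → ℝ}
  {E : Type*} [NormedAddCommGroup E] [InnerProductSpace ℝ E] [MeasurableSpace E]
  [BorelSpace E] [SecondCountableTopology E] {b : Fin N → E} {D : ℝ} {u : Fin n → ℝ} {m : ℝ}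

omit [IsProbabilityMeasure μ] in
theorem indep_row_sum (h : SparseFamily μ q a) (u : Fin n → ℝ) {f : ℝ → ℝ} (hf : Measurable f) :
    iIndepFun (fun i ω => f (∑ j, u j * a i j ω)) μ :=
  (ProbabilityTheory.iIndepFun.rows h.meas h.indep).comp (fun _ x => f (∑ j, u j * x j))
    fun _ => hf.comp (by fun_prop)

/-- The contribution of the row sums below the truncation level. -/
theorem expBdd_trunc (h : SparseFamily μ q a) (hq : 0 ≤ q)
    (hb : ∀ y, ∑ i, inner ℝ (b i) y ^ 2 ≤ ‖y‖ ^ 2) (hbn : ∑ i, ‖b i‖ ^ 2 ≤ n)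
    (hu : ∀ j, |u j| ≤ 1) (hum : ∑ j, u j ^ 2 = m) {ℓ : ℝ} (hℓ : 1 ≤ ℓ) (hD : 0 < D)
    (hℓD : ℓ ≤ 2 * D) (hmD : m * q * Real.exp (ℓ / 2) ≤ 32 * D / ℓ ^ 2) :
    ExpBdd μ (fun ω => ℓ / (8192 * D) *
      ‖∑ i, trunc (24 * D / ℓ) (∑ j, u j * a i j ω) • b i‖ ^ 2)
      (ℓ / (8192 * D) * (192 * (m * q)) * n) := by
  obtain ⟨T, hT, haT⟩ := h.symm
  have hm0 : 0 ≤ m := hum ▸ Finset.sum_nonneg fun _ _ => sq_nonneg _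
  have hℓ0 : 0 < ℓ := by linarith
  have hmeas : ∀ i, Measurable fun ω => ∑ j, u j * a i j ω := fun i => by
    have := h.meas i; fun_prop
  have hodd : ∀ i ω, ∑ j, u j * a i j (T ω) = -∑ j, u j * a i j ω := fun i ω => by
    simp [haT]
  have hsub : ∀ i t, ExpBdd μ (fun ω => t * trunc (24 * D / ℓ) (∑ j, u j * a i j ω))
      (48 * D / ℓ * t ^ 2) := fun i t => by
    refine ExpBdd.trunc_gaussian hT (hmeas i) (hodd i) hℓ0 (by positivity)
      (mul_nonneg hm0 hq) (fun t => hum ▸ h.expBdd_row_sum hq i hu t) (hmD.trans ?_) ?_ t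
    · rw [mul_div_assoc']
      refine div_le_div₀ (by positivity) (by linarith) hℓ0 (by nlinarith)
    · rw [div_mul_cancel₀ _ hℓ0.ne', mul_div_assoc', div_le_iff₀ hℓ0]
      nlinarith
  have hmgf : ∀ i t, ExpBdd μ (fun ω => t * trunc (24 * D / ℓ) (∑ j, u j * a i j ω))
      (m * q * t ^ 2 * Real.exp (|t| * 1) / 2) := fun i t => by
    have hm := (measurable_trunc (24 * D / ℓ)).comp (hmeas i)
    simp only [Function.comp_def] at hm
    have hmi := hmeas i
    rw [mul_one, ← hum]
    refine (h.expBdd_row_sum hq i hu t).of_abs_le_of_symm hT (by fun_prop) (by fun_prop)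
      (fun ω => by rw [hodd, trunc_neg]; ring) (fun ω => by rw [hodd]; ring) fun ω => ?_
    rw [abs_mul, abs_mul]
    exact mul_le_mul_of_nonneg_left (abs_trunc_le_abs _ _) (abs_nonneg t)
  have hl : ℓ / (8192 * D) ≤ 1 / 4096 := by
    rw [div_le_div_iff₀ (by positivity) (by norm_num)]; linarith
  -- The product of `l` with the subgaussian constant `48D/ℓ` is absolute; `8192` is large enough
  -- that it stays below the required `1/16` even after multiplication by `8`.
  have hlq : ℓ / (8192 * D) * (48 * D / ℓ) = 48 / 8192 := by field_simp
  have hfin := expBdd_norm_sum_sq (v := b) (l := ℓ / (8192 * D)) (q := 48 * D / ℓ)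
    (r := 192 * (m * q)) (by positivity) (by positivity) (by rw [hlq]; norm_num)
    (fun i => (measurable_trunc _).comp (hmeas i)) (h.indep_row_sum u (measurable_trunc _)) hsub
    (fun i => expBdd_sq_of_mgf ((measurable_trunc _).comp (hmeas i)) (by positivity)
      (mul_nonneg hm0 hq) (by rw [mul_assoc, hlq]; norm_num) (by linarith) (hsub i) (hmgf i)) hb
  exact hfin.mono_right (mul_le_mul_of_nonneg_left hbn (by positivity))

/-- The contribution of the row sums above the truncation level. -/
theorem expBdd_sum_abs_sub_trunc (h : SparseFamily μ q a) (hq : 0 ≤ q)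
    (hND : Real.log (2 * N) ≤ D) (hN : 0 < N)
    (hu : ∀ j, |u j| ≤ 1) (hum : ∑ j, u j ^ 2 = m) {ℓ : ℝ} (hℓ : 1 ≤ ℓ)
    (hmD : m * q * Real.exp (ℓ / 2) ≤ 32 * D / ℓ ^ 2) :
    ExpBdd μ (fun ω => ∑ i, ℓ / 4 * |∑ j, u j * a i j ω -
      trunc (24 * D / ℓ) (∑ j, u j * a i j ω)|) 1 := by
  have hℓ0 : 0 < ℓ := by linarith
  have hmeas : ∀ i, Measurable fun ω => ∑ j, u j * a i j ω := fun i => by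
    have := h.meas i; fun_prop
  have hN' : (0 : ℝ) < N := Nat.cast_pos.2 hN
  have h1 : ∀ i, ExpBdd μ (fun ω => 2 * (ℓ / 4) * |∑ j, u j * a i j ω|)
      (4 * D + Real.log 2) := fun i => by
    have hb : m * q * (ℓ / 2) ^ 2 * Real.exp |ℓ / 2| / 2 ≤ 4 * D := by
      rw [abs_of_nonneg (by positivity)]
      rw [le_div_iff₀ (by positivity)] at hmD
      nlinarith
    have e1 := (hum ▸ h.expBdd_row_sum hq i hu (ℓ / 2)).mono_right hb
    have e2 := h.expBdd_row_sum hq i hu (-(ℓ / 2))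
    rw [hum, abs_neg, neg_sq] at e2
    have e3 := e2.mono_right hb
    simp_rw [neg_mul] at e3
    refine (e1.abs_of_neg e3 (by have := hmeas i; fun_prop)).mono fun ω => ?_
    rw [abs_mul, abs_of_nonneg (show 0 ≤ ℓ / 2 by positivity)]
    ring_nf
    exact le_refl _
  -- The level `24D/ℓ` makes `θR = 6D`. The remaining `log 2 - 2D` is at most `-log N`, so each row
  -- contributes `1/N` and all rows together contribute `1`.
  have h2 : Real.exp (4 * D + Real.log 2 - ℓ / 4 * (24 * D / ℓ)) ≤ 1 / N := by
    have e : 4 * D + Real.log 2 - ℓ / 4 * (24 * D / ℓ) = Real.log 2 - 2 * D := by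
      field_simp; ring
    have e2 : Real.log (2 * N) = Real.log 2 + Real.log N :=
      Real.log_mul two_ne_zero hN'.ne'
    have e3 : 0 ≤ Real.log N := Real.log_nonneg (by exact_mod_cast hN)
    have e4 : 0 < Real.log 2 := Real.log_pos one_lt_two
    rw [e, one_div, ← Real.exp_log (inv_pos.2 hN'), Real.log_inv]
    exact Real.exp_le_exp.2 (by linarith)
  have h3 := fun i => (h1 i).abs_sub_trunc (by positivity) h2
  have hmt : Measurable fun x : ℝ => ℓ / 4 * |x - trunc (24 * D / ℓ) x| := by
    have := measurable_trunc (24 * D / ℓ)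
    fun_prop
  refine (ExpBdd.sum_of_iIndepFun h3 (fun i => hmt.comp (hmeas i)) (h.indep_row_sum u hmt)
    Finset.univ).mono_right ?_
  simp [hN'.ne']

/-- A tail bound for `‖BAu‖` where `u` is a vector with small coordinates. -/
theorem measure_level_le (h : SparseFamily μ q a) (hq : 0 ≤ q)
    (hb : ∀ y, ∑ i, inner ℝ (b i) y ^ 2 ≤ ‖y‖ ^ 2) (hbn : ∑ i, ‖b i‖ ^ 2 ≤ n)
    (hnN : n ≤ N) (hqD : n * q ≤ D) (hND : Real.log (2 * N) ≤ D)
    (hu : ∀ j, |u j| ≤ 1) (hum : ∑ j, u j ^ 2 = m) (hm : 1 ≤ m) (hmn : m ≤ n) :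
    μ {ω | (∀ i, ∑ j, |a i j ω| ≤ 6 * D) ∧
      100000 * (m * D) < ‖∑ i, (∑ j, u j * a i j ω) • b i‖ ^ 2} ≤
      ENNReal.ofReal (2 * Real.exp (-(2 * (m * (1 + Real.log (n / m))) + 2 * D))) := by
  have hm0 : 0 < m := by linarith
  have hn0 : (0 : ℝ) < n := by linarith
  have hN1 : 0 < N := lt_of_lt_of_le (by exact_mod_cast hn0) hnN
  have hN0 : (0 : ℝ) < N := by exact_mod_cast hN1
  have hlog2 : 1 / 2 ≤ Real.log 2 := by linarith [Real.log_two_gt_d9]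
  have hlogN : 0 ≤ Real.log N := Real.log_nonneg (by exact_mod_cast hN1)
  have hND' : Real.log 2 + Real.log N ≤ D := by
    rwa [← Real.log_mul two_ne_zero hN0.ne']
  have hD : 0 < D := by linarith
  set ℓ := 1 + Real.log (n / m) with hℓdef
  have hnm : 1 ≤ n / m := (one_le_div hm0).2 hmn
  have hℓ : 1 ≤ ℓ := by linarith [Real.log_nonneg hnm]
  have hℓ0 : 0 < ℓ := by linarith
  have hmeas : ∀ i, Measurable fun ω => ∑ j, u j * a i j ω := fun i => by
    have := h.meas i; fun_prop
  -- If the entropy `mℓ` is below `D`, the bound for one fixed unit vector, `u/√m`, already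
  -- suffices. Truncation is needed only when `mℓ` dominates `D`.
  rcases le_total (m * ℓ) D with hcase | hcase
  · set x : Fin n → ℝ := fun j => (√m)⁻¹ * u j
    have hx : ∑ j, x j ^ 2 ≤ 1 := by
      simp only [x, mul_pow, ← Finset.mul_sum, hum, inv_pow, Real.sq_sqrt hm0.le]
      exact (inv_mul_cancel₀ hm0.ne').le
    have h1 := h.expBdd_norm_sq hq hb hbn hx
    have e : ∀ ω, ‖∑ i, (∑ j, x j * a i j ω) • b i‖ ^ 2 =
        m⁻¹ * ‖∑ i, (∑ j, u j * a i j ω) • b i‖ ^ 2 := fun ω => by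
      simp only [x, mul_assoc, ← Finset.mul_sum, mul_smul, ← Finset.smul_sum]
      rw [norm_smul, mul_pow, Real.norm_eq_abs, sq_abs, inv_pow, Real.sq_sqrt hm0.le]
    simp_rw [e] at h1
    refine le_trans (measure_mono ?_) ((h1.measure_le ?_ (12500 * D)).trans ?_)
    · rintro ω ⟨-, hω⟩
      have : 100000 * D ≤ m⁻¹ * ‖∑ i, (∑ j, u j * a i j ω) • b i‖ ^ 2 := by
        rw [inv_mul_eq_div, le_div_iff₀ hm0]
        linarith
      change 12500 * D ≤ 1 / 8 * _
      linarith
    · have := fun i => (hmeas i).smul_const (b i)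
      fun_prop
    · refine ENNReal.ofReal_le_ofReal ?_
      have : Real.exp (n * q - 12500 * D) ≤ Real.exp (-(2 * (m * ℓ) + 2 * D)) :=
        Real.exp_le_exp.2 (by linarith)
      linarith [Real.exp_pos (-(2 * (m * ℓ) + 2 * D))]
  · have hℓD : ℓ ≤ 2 * D := by
      have h1 : Real.log (n / m) ≤ Real.log N := by
        refine Real.log_le_log (by positivity) ((div_le_self hn0.le hm).trans ?_)
        exact_mod_cast hnN
      linarith
    have hmD : m * q * Real.exp (ℓ / 2) ≤ 32 * D / ℓ ^ 2 := by
      rw [le_div_iff₀ (by positivity)]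
      have h1 := Real.sq_log_mul_exp_half_le hnm
      rw [← hℓdef] at h1
      calc m * q * Real.exp (ℓ / 2) * ℓ ^ 2 = m * q * (ℓ ^ 2 * Real.exp (ℓ / 2)) := by ring
        _ ≤ m * q * (32 * (n / m)) := mul_le_mul_of_nonneg_left h1 (by positivity)
        _ = 32 * (n * q) := by field_simp
        _ ≤ _ := by linarith
    set R := 24 * D / ℓ
    have hmt : ∀ i, Measurable fun ω => trunc R (∑ j, u j * a i j ω) :=
      fun i => (measurable_trunc R).comp (hmeas i)
    have h1 := (h.expBdd_trunc hq hb hbn hu hum hℓ hD hℓD hmD).measure_le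
      (by have := fun i => (hmt i).smul_const (b i); fun_prop)
      (ℓ / (8192 * D) * (33000 * (m * D)))
    have h2 := (h.expBdd_sum_abs_sub_trunc hq hND hN1 hu hum hℓ hmD).measure_le
      (by fun_prop) (1 + 4 * (m * ℓ))
    refine le_trans (measure_mono (fun ω hω => ?_)) ((measure_union_le _ _).trans
      ((add_le_add h1 h2).trans ?_))
    · obtain ⟨hrow, hω⟩ := hω
      by_contra hc
      simp only [Set.mem_union, Set.mem_ofPred_eq, not_or, not_le] at hc
      obtain ⟨hc1, hc2⟩ := hc
      have hc1' : ‖∑ i, trunc R (∑ j, u j * a i j ω) • b i‖ ^ 2 < 33000 * (m * D) :=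
        lt_of_mul_lt_mul_left hc1 (by positivity)
      rw [← Finset.mul_sum] at hc2
      set η : Fin N → ℝ := fun i => ∑ j, u j * a i j ω with hη
      -- Each excess is at most the `ℓ¹` norm of its row, hence `6D`, so the squared `ℓ²` norm is at
      -- most `6D` times the `ℓ¹` norm.
      have h3 : ‖∑ i, (η i - trunc R (η i)) • b i‖ ^ 2 ≤
          6 * D * ∑ i, |η i - trunc R (η i)| := by
        refine (norm_sum_smul_sq_le hb _).trans ?_
        rw [Finset.mul_sum]
        refine Finset.sum_le_sum fun i _ => ?_
        have h4 : |η i - trunc R (η i)| ≤ 6 * D := by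
          have h5 : |η i| ≤ 6 * D := by
            refine (Finset.abs_sum_le_sum_abs _ _).trans (le_trans ?_ (hrow i))
            refine Finset.sum_le_sum fun j _ => ?_
            rw [abs_mul]
            exact mul_le_of_le_one_left (abs_nonneg _) (hu j)
          unfold trunc
          split_ifs
          · simp [hD.le]
          · simpa using h5
        rw [← sq_abs, sq]
        exact mul_le_mul_of_nonneg_right h4 (abs_nonneg _)
      have h6 : ∑ i, η i • b i = ∑ i, trunc R (η i) • b i + ∑ i, (η i - trunc R (η i)) • b i := by
        rw [← Finset.sum_add_distrib]
        exact Finset.sum_congr rfl fun i _ => by rw [← add_smul]; congr 1; ring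
      have h7 := norm_add_sq_le_two_mul (∑ i, trunc R (η i) • b i)
        (∑ i, (η i - trunc R (η i)) • b i)
      rw [← h6] at h7
      have h8 : ∑ i, |η i - trunc R (η i)| ≤ 20 * m := by
        have : ℓ * ∑ i, |η i - trunc R (η i)| ≤ ℓ * (20 * m) := by nlinarith
        exact le_of_mul_le_mul_left this hℓ0
      have h9 := mul_le_mul_of_nonneg_left h8 (show 0 ≤ 6 * D by positivity)
      have h10 : 0 < m * D := by positivity
      linarith
    · rw [← ENNReal.ofReal_add (Real.exp_pos _).le (Real.exp_pos _).le, two_mul]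
      refine ENNReal.ofReal_le_ofReal (add_le_add ?_ ?_) <;> refine Real.exp_le_exp.2 ?_
      -- Since `33000 - 192 ≥ 4 · 8192`, the exponent is below `-4mℓ`, and `mℓ ≥ D` splits this into
      -- `-2mℓ - 2D`.
      · have h3 : ℓ / (8192 * D) * (33000 * (m * D)) = 33000 / 8192 * (m * ℓ) := by
          field_simp
        have h4 : ℓ / (8192 * D) * (192 * (m * q)) * n ≤ 192 / 8192 * (m * ℓ) := by
          have : ℓ / (8192 * D) * (192 * (m * q)) * n = 192 / 8192 * (m * ℓ) * (n * q / D) := by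
            field_simp
          rw [this]
          exact mul_le_of_le_one_right (by positivity) ((div_le_one hD).2 hqD)
        rw [h3]
        linarith [mul_pos hm0 hℓ0]
      · linarith

end SparseFamily

/-! ### Sign vectors, dyadic approximation and entropy. -/

/-- The number of nonzero coordinates of a sign vector. -/
def signSupp {n : ℕ} (σ : Fin n → SignType) : ℕ := (Finset.univ.filter fun j => σ j ≠ 0).card

theorem SignType.coe_sq (s : SignType) : ((s : ℝ)) ^ 2 = if s ≠ 0 then 1 else 0 := by
  cases s <;> simp

theorem SignType.abs_coe_le (s : SignType) : |(s : ℝ)| ≤ 1 := by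
  cases s <;> simp

theorem sum_sign_sq {n : ℕ} (σ : Fin n → SignType) : ∑ j, ((σ j : ℝ)) ^ 2 = signSupp σ := by
  simp_rw [SignType.coe_sq, signSupp]
  rw [Finset.sum_boole]

theorem signSupp_le {n : ℕ} (σ : Fin n → SignType) : signSupp σ ≤ n :=
  (Finset.card_filter_le _ _).trans_eq (by simp)

theorem sum_pow_signSupp {n : ℕ} (z : ℝ) :
    ∑ σ : Fin n → SignType, z ^ signSupp σ = (1 + 2 * z) ^ n := by
  have h := Finset.prod_univ_sum (fun _ : Fin n => (Finset.univ : Finset SignType))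
    (fun _ s => if s ≠ 0 then z else 1)
  have h1 : ∑ s : SignType, (if s ≠ 0 then z else 1) = 1 + 2 * z := by
    have : (Finset.univ : Finset SignType) = {0, -1, 1} := rfl
    rw [this, Finset.sum_insert (by decide), Finset.sum_insert (by decide),
      Finset.sum_singleton]
    simp
    ring
  rw [h1, Finset.prod_const, Finset.card_univ, Fintype.card_fin, Fintype.piFinset_univ] at h
  rw [h]
  refine Finset.sum_congr rfl fun σ _ => ?_
  rw [Finset.prod_ite, Finset.prod_const, Finset.prod_const_one, mul_one]
  rfl

/-- Weight each vector by `z` to the size of its support. The total is `(1 + 2z)ⁿ ≤ exp (2s)` at `z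
= s/n`, while each counted vector weighs at least `zˢ`. -/
theorem card_signSupp_le {n s : ℕ} (hs : 1 ≤ s) (hsn : s ≤ n) :
    ((Finset.univ.filter fun σ : Fin n → SignType => signSupp σ ≤ s).card : ℝ) ≤
      Real.exp (2 * (s * (1 + Real.log (n / s)))) := by
  have hs0 : (0 : ℝ) < s := by exact_mod_cast hs
  have hn0 : (0 : ℝ) < n := by exact_mod_cast hs.trans hsn
  set z : ℝ := s / n with hz
  have hz0 : 0 < z := by positivity
  have hz1 : z ≤ 1 := (div_le_one hn0).2 (by exact_mod_cast hsn)
  have hlog : 0 ≤ Real.log (n / s) :=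
    Real.log_nonneg ((one_le_div hs0).2 (by exact_mod_cast hsn))
  have h1 : ((Finset.univ.filter fun σ : Fin n → SignType => signSupp σ ≤ s).card : ℝ) * z ^ s ≤
      (1 + 2 * z) ^ n := by
    rw [← sum_pow_signSupp, ← nsmul_eq_mul]
    refine (Finset.card_nsmul_le_sum _ (fun σ => z ^ signSupp σ) _ fun σ hσ =>
      pow_le_pow_of_le_one hz0.le hz1 (Finset.mem_filter.1 hσ).2).trans ?_
    exact Finset.sum_le_sum_of_subset_of_nonneg (Finset.filter_subset _ _)
      fun _ _ _ => by positivity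
  have h2 : (1 + 2 * z) ^ n ≤ Real.exp (2 * s) := by
    calc (1 + 2 * z) ^ n ≤ Real.exp (2 * z) ^ n := by
          gcongr
          linarith [Real.add_one_le_exp (2 * z)]
      _ = Real.exp (2 * s) := by
          rw [← Real.exp_nat_mul, hz]
          congr 1
          field_simp
  have h3 : z ^ s = Real.exp (-(s * Real.log (n / s))) := by
    rw [← Real.exp_log hz0, ← Real.exp_nat_mul, hz, ← inv_div (n : ℝ) s, Real.log_inv]
    ring_nf
  rw [h3, Real.exp_neg, ← div_eq_mul_inv, div_le_iff₀ (Real.exp_pos _)] at h1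
  refine h1.trans ((mul_le_mul_of_nonneg_right h2 (Real.exp_pos _).le).trans ?_)
  rw [← Real.exp_add]
  exact Real.exp_le_exp.2 (by nlinarith)

/-- Dyadic approximation of a real number in `[-1, 1]`. -/
theorem exists_dyadic_approx (K : ℕ) {t : ℝ} (ht : |t| ≤ 1) : ∃ τ : ℕ → SignType,
    (∀ k₀, (∑ k ∈ Finset.range k₀, (2⁻¹ : ℝ) ^ k * τ k) ^ 2 ≤ t ^ 2) ∧
    (∑ k ∈ Finset.range (K + 1), ((2⁻¹ : ℝ) ^ k * τ k) ^ 2 ≤ t ^ 2) ∧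
    (t - ∑ k ∈ Finset.range (K + 1), (2⁻¹ : ℝ) ^ k * τ k) ^ 2 ≤ t ^ 2 / 4 + (4⁻¹ : ℝ) ^ K := by
  classical
  have h4 : ∀ k : ℕ, ((2⁻¹ : ℝ) ^ k) ^ 2 = (4⁻¹ : ℝ) ^ k := fun k => by
    rw [← pow_mul, mul_comm, pow_mul]; norm_num
  by_cases hK : (2⁻¹ : ℝ) ^ K ≤ |t|
  · have hex : ∃ k : ℕ, (2⁻¹ : ℝ) ^ k ≤ |t| := ⟨K, hK⟩
    set κ := Nat.find hex
    have hκ : (2⁻¹ : ℝ) ^ κ ≤ |t| := Nat.find_spec hex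
    have hκK : κ ≤ K := Nat.find_min' hex hK
    have ht0 : t ≠ 0 := by
      rintro rfl
      rw [abs_zero] at hκ
      exact absurd hκ (not_le.2 (by positivity))
    have hs1 : ((SignType.sign t : SignType) : ℝ) ^ 2 = 1 := by
      rw [SignType.coe_sq]; simp [ht0]
    have hsum : ∀ k₀, ∑ k ∈ Finset.range k₀,
        (2⁻¹ : ℝ) ^ k * ((if k = κ then SignType.sign t else 0 : SignType) : ℝ) =
        if κ < k₀ then (2⁻¹ : ℝ) ^ κ * (SignType.sign t : ℝ) else 0 := fun k₀ => by
      have : ∀ k, (2⁻¹ : ℝ) ^ k * ((if k = κ then SignType.sign t else 0 : SignType) : ℝ) =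
          if k = κ then (2⁻¹ : ℝ) ^ k * (SignType.sign t : ℝ) else 0 := fun k => by
        split_ifs <;> simp
      simp_rw [this]
      rw [Finset.sum_ite_eq']
      simp
    have hle : ((2⁻¹ : ℝ) ^ κ * (SignType.sign t : ℝ)) ^ 2 ≤ t ^ 2 := by
      rw [mul_pow, hs1, mul_one, ← sq_abs t]
      exact pow_le_pow_left₀ (by positivity) hκ 2
    -- A single nonzero digit: `2⁻ᵏ` at `k = κ` is the largest such power not exceeding `|t|`, so
    -- the error is at most `|t|/2`. Values below `2⁻ᴷ` are approximated by zero.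
    refine ⟨fun k => if k = κ then SignType.sign t else 0, fun k₀ => ?_, ?_, ?_⟩
    · rw [hsum]
      split_ifs
      · exact hle
      · simpa using sq_nonneg t
    · have : ∀ k, ((2⁻¹ : ℝ) ^ k * ((if k = κ then SignType.sign t else 0 : SignType) : ℝ)) ^ 2 =
          if k = κ then ((2⁻¹ : ℝ) ^ k * (SignType.sign t : ℝ)) ^ 2 else 0 := fun k => by
        split_ifs <;> simp
      simp_rw [this]
      rw [Finset.sum_ite_eq', if_pos (by simpa using Nat.lt_succ_of_le hκK)]
      exact hle
    · rw [hsum, if_pos (Nat.lt_succ_of_le hκK)]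
      have hup : |t| ≤ 2 * (2⁻¹ : ℝ) ^ κ := by
        rcases Nat.eq_zero_or_pos κ with h0 | h0
        · rw [h0]; simp; linarith
        · have h1 := Nat.find_min hex (Nat.sub_lt h0 one_pos)
          push Not at h1
          have h2 : (2 : ℝ) * 2⁻¹ ^ κ = 2⁻¹ ^ (κ - 1) := by
            conv_lhs => rw [← Nat.sub_add_cancel h0, pow_succ]
            ring
          rw [h2]
          exact h1.le
      have h5 : t = |t| * (SignType.sign t : ℝ) := by
        rw [mul_comm]; exact (sign_mul_abs t).symm
      have h6 : t - (2⁻¹ : ℝ) ^ κ * (SignType.sign t : ℝ) =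
          (|t| - (2⁻¹ : ℝ) ^ κ) * (SignType.sign t : ℝ) := by
        rw [sub_mul, ← h5]
      rw [h6, mul_pow, hs1, mul_one]
      have h7 : 0 ≤ (4⁻¹ : ℝ) ^ K := by positivity
      have h8 : (|t| - (2⁻¹ : ℝ) ^ κ) ^ 2 ≤ (|t| / 2) ^ 2 :=
        pow_le_pow_left₀ (by linarith) (by linarith) 2
      rw [div_pow, sq_abs] at h8
      linarith
  · push Not at hK
    refine ⟨fun _ => 0, fun k₀ => by simpa using sq_nonneg t, by simpa using sq_nonneg t, ?_⟩
    simp only [SignType.coe_zero, mul_zero, Finset.sum_const_zero, sub_zero]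
    have := pow_le_pow_left₀ (abs_nonneg t) hK.le 2
    rw [sq_abs, h4] at this
    linarith [sq_nonneg t]

/-- The vector with the given dyadic layers. -/
noncomputable def dyadicVec {n : ℕ} (k₀ : ℕ) (τ : ℕ → Fin n → SignType) : Fin n → ℝ :=
  fun j => ∑ k ∈ Finset.range k₀, (2⁻¹ : ℝ) ^ k * τ k j

/-- Approximation is done coordinatewise with no more than one nonzero layer per coordinate, so the
weighted support sizes add up to the squared norm of the approximant. The error is at most `1/4 + n
4⁻ᴷ ≤ 5/16`; the stated `9/16` is the square of the contraction factor `3/4`. -/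
theorem exists_dyadicVec {n : ℕ} {K : ℕ} (hK : 16 * n ≤ 4 ^ K) {y : Fin n → ℝ}
    (hy : ∑ j, y j ^ 2 ≤ 1) : ∃ τ : ℕ → Fin n → SignType,
    (∀ k₀, ∑ j, dyadicVec k₀ τ j ^ 2 ≤ 1) ∧
    (∑ k ∈ Finset.range (K + 1), (4⁻¹ : ℝ) ^ k * signSupp (τ k) ≤ 1) ∧
    ∑ j, (y j - dyadicVec (K + 1) τ j) ^ 2 ≤ 9 / 16 := by
  have hyj : ∀ j, |y j| ≤ 1 := fun j => by
    rw [← sq_le_one_iff_abs_le_one]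
    exact (Finset.single_le_sum (f := fun j => y j ^ 2) (fun _ _ => sq_nonneg _)
      (Finset.mem_univ j)).trans hy
  choose τ h1 h2 h3 using fun j => exists_dyadic_approx K (hyj j)
  refine ⟨fun k j => τ j k, fun k₀ => ?_, ?_, ?_⟩
  · exact (Finset.sum_le_sum fun j _ => h1 j k₀).trans hy
  · calc ∑ k ∈ Finset.range (K + 1), (4⁻¹ : ℝ) ^ k * signSupp (fun j => τ j k)
        = ∑ k ∈ Finset.range (K + 1), ∑ j, ((2⁻¹ : ℝ) ^ k * τ j k) ^ 2 := by
          refine Finset.sum_congr rfl fun k _ => ?_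
          rw [← sum_sign_sq, Finset.mul_sum]
          refine Finset.sum_congr rfl fun j _ => ?_
          rw [mul_pow, ← pow_mul, mul_comm k 2, pow_mul]
          norm_num
      _ ≤ 1 := by
          rw [Finset.sum_comm]
          exact (Finset.sum_le_sum fun j _ => h2 j).trans hy
  · refine (Finset.sum_le_sum fun j _ => h3 j).trans ?_
    rw [Finset.sum_add_distrib, ← Finset.sum_div, Finset.sum_const, Finset.card_univ,
      Fintype.card_fin, nsmul_eq_mul]
    have h4 : (n : ℝ) * (4⁻¹) ^ K ≤ 1 / 16 := by
      rw [inv_pow, ← div_eq_mul_inv, div_le_div_iff₀ (by positivity) (by norm_num)]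
      have : (16 * n : ℝ) ≤ 4 ^ K := by exact_mod_cast hK
      linarith
    linarith

/-- The operator norm is controlled by the values on dyadic vectors. -/
theorem opNorm_le_of_dyadicVec {E : Type*} [NormedAddCommGroup E] [NormedSpace ℝ E] {n : ℕ}
    {K : ℕ} (hK : 16 * n ≤ 4 ^ K) (f : EuclideanSpace ℝ (Fin n) →L[ℝ] E) {c : ℝ} (hc : 0 ≤ c)
    (hf : ∀ τ : ℕ → Fin n → SignType, (∀ k₀, ∑ j, dyadicVec k₀ τ j ^ 2 ≤ 1) →
      (∑ k ∈ Finset.range (K + 1), (4⁻¹ : ℝ) ^ k * signSupp (τ k) ≤ 1) →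
      ‖f (WithLp.toLp 2 (dyadicVec (K + 1) τ))‖ ≤ c) : ‖f‖ ≤ 4 * c := by
  have h : ‖f‖ ≤ c + 3 / 4 * ‖f‖ := by
    refine f.opNorm_le_of_unit_norm (by positivity) fun y hy => ?_
    have hy1 : ∑ j, y j ^ 2 ≤ 1 := by
      rw [← EuclideanSpace.real_norm_sq_eq, hy]; norm_num
    obtain ⟨τ, h1, h2, h3⟩ := exists_dyadicVec hK hy1
    set x : EuclideanSpace ℝ (Fin n) := WithLp.toLp 2 (dyadicVec (K + 1) τ)
    have h4 : ‖y - x‖ ≤ 3 / 4 := by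
      have : ‖y - x‖ ^ 2 ≤ (3 / 4) ^ 2 := by
        rw [EuclideanSpace.real_norm_sq_eq]
        refine le_trans (le_of_eq ?_) (h3.trans (by norm_num))
        rfl
      exact le_of_sq_le_sq this (by norm_num)
    calc ‖f y‖ = ‖f x + f (y - x)‖ := by rw [← map_add, add_sub_cancel]
      _ ≤ ‖f x‖ + ‖f (y - x)‖ := norm_add_le _ _
      _ ≤ c + ‖f‖ * (3 / 4) := add_le_add (hf τ h1 h2)
          ((f.le_opNorm _).trans (mul_le_mul_of_nonneg_left h4 (norm_nonneg f)))
      _ = _ := by ring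
  linarith

/-- The total entropy of the dyadic levels below `M`. -/
theorem sum_level_entropy_le {n M : ℝ} (hM : 0 < M) (hMn : M ≤ n) {k₀ : ℕ}
    (hk : ∀ k < k₀, (4 : ℝ) ^ k ≤ M) :
    ∑ k ∈ Finset.range k₀, (4 : ℝ) ^ k * (1 + Real.log (n / 4 ^ k)) ≤
      4 / 3 * M * (1 + Real.log (n / M)) + 4 * M := by
  have hn : 0 < n := hM.trans_le hMn
  rcases Nat.eq_zero_or_pos k₀ with rfl | h0
  · have := Real.log_nonneg ((one_le_div hM).2 hMn)
    simp only [Finset.range_zero, Finset.sum_empty]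
    positivity
  have hlast := hk (k₀ - 1) (Nat.sub_lt h0 one_pos)
  have hlog := Real.log_nonneg ((one_le_div hM).2 hMn)
  have h4 : (4 : ℝ) ^ k₀ = 4 * 4 ^ (k₀ - 1) := by
    conv_lhs => rw [← Nat.sub_add_cancel h0, pow_succ]
    ring
  have h2 : (2 : ℝ) ^ k₀ = 2 * 2 ^ (k₀ - 1) := by
    conv_lhs => rw [← Nat.sub_add_cancel h0, pow_succ]
    ring
  have h24 : ∀ k : ℕ, ((2 : ℝ) ^ k) ^ 2 = 4 ^ k := fun k => by
    rw [← pow_mul, mul_comm, pow_mul]; norm_num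
  have hterm : ∀ k ∈ Finset.range k₀, (4 : ℝ) ^ k * (1 + Real.log (n / 4 ^ k)) ≤
      4 ^ k * (1 + Real.log (n / M)) + 2 * √M * 2 ^ k := by
    intro k _
    have h5 : Real.log (n / 4 ^ k) = Real.log (n / M) + Real.log (M / 4 ^ k) := by
      rw [← Real.log_mul (by positivity) (by positivity)]
      congr 1
      field_simp
    -- Writing the logarithm as `2 log (√M / 2ᵏ)` before linearizing turns the excess entropy into a
    -- geometric series in `2ᵏ`, of order `M` in total.
    have h6 : Real.log (M / 4 ^ k) ≤ 2 * (√M / 2 ^ k) := by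
      have h7 : M / 4 ^ k = (√M / 2 ^ k) ^ 2 := by
        rw [div_pow, Real.sq_sqrt hM.le, h24]
      have hpos : 0 < √M / 2 ^ k := by positivity
      rw [h7, Real.log_pow]
      push_cast
      linarith [Real.log_le_sub_one_of_pos hpos]
    have h8 : (4 : ℝ) ^ k * (2 * (√M / 2 ^ k)) = 2 * √M * 2 ^ k := by
      rw [← h24]; field_simp
    have h9 := mul_le_mul_of_nonneg_left h6 (show (0 : ℝ) ≤ 4 ^ k by positivity)
    rw [h8] at h9
    rw [h5]
    linarith
  refine (Finset.sum_le_sum hterm).trans ?_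
  rw [Finset.sum_add_distrib, ← Finset.sum_mul, ← Finset.mul_sum, geom_sum_eq (by norm_num),
    geom_sum_eq (by norm_num)]
  have hs : √M ^ 2 = M := Real.sq_sqrt hM.le
  have hs2 : (2 : ℝ) ^ (k₀ - 1) ≤ √M := by
    refine Real.le_sqrt_of_sq_le ?_
    rw [h24]; exact hlast
  have h10 : ((4 : ℝ) ^ k₀ - 1) / (4 - 1) ≤ 4 / 3 * M := by linarith
  have h11 : ((2 : ℝ) ^ k₀ - 1) / (2 - 1) ≤ 2 * √M := by linarith
  have h12 := mul_le_mul_of_nonneg_right h10 (show 0 ≤ 1 + Real.log (n / M) by linarith)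
  have h13 := mul_le_mul_of_nonneg_left h11 (show 0 ≤ 2 * √M by positivity)
  nlinarith

/-! ### The product matrix as an operator, and its values on dyadic vectors. -/

/-- The operator with rows `A i`, followed by the operator with columns `b i`. -/
noncomputable def colRowOp {E : Type*} [NormedAddCommGroup E] [NormedSpace ℝ E] {N n : ℕ}
    (b : Fin N → E) (A : Fin N → Fin n → ℝ) : EuclideanSpace ℝ (Fin n) →L[ℝ] E :=
  ∑ i, (innerSL ℝ (WithLp.toLp 2 (A i))).smulRight (b i)

theorem colRowOp_apply {E : Type*} [NormedAddCommGroup E] [NormedSpace ℝ E] {N n : ℕ}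
    (b : Fin N → E) (A : Fin N → Fin n → ℝ) (x : Fin n → ℝ) :
    colRowOp b A (WithLp.toLp 2 x) = ∑ i, (∑ j, x j * A i j) • b i := by
  simp [colRowOp, PiLp.inner_apply]

/-- The columns of a matrix. -/
noncomputable def matrixCol {m N : ℕ} (B : Matrix (Fin m) (Fin N) ℝ) (i : Fin N) :
    EuclideanSpace ℝ (Fin m) := WithLp.toLp 2 fun k => B k i

theorem norm_mul_eq_colRowOp {m N n : ℕ} (B : Matrix (Fin m) (Fin N) ℝ)
    (A : Fin N → Fin n → ℝ) : ‖B * Matrix.of A‖ = ‖colRowOp (matrixCol B) A‖ := by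
  rw [Matrix.l2_opNorm_def]
  congr 1
  ext x k
  have hx : x = WithLp.toLp 2 x.ofLp := rfl
  rw [hx, colRowOp_apply]
  simp only [LinearEquiv.trans_apply, LinearMap.coe_toContinuousLinearMap',
    Matrix.toLpLin_toLp, Matrix.toLin'_apply, WithLp.ofLp_sum, Finset.sum_apply, WithLp.ofLp_smul,
    Pi.smul_apply, matrixCol, smul_eq_mul, ← Matrix.mulVec_mulVec]
  simp only [Matrix.mulVec, dotProduct, Matrix.of_apply]
  refine Finset.sum_congr rfl fun i _ => ?_
  rw [mul_comm]
  congr 1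
  exact Finset.sum_congr rfl fun j _ => mul_comm _ _

/-- The left side is `‖Bᵀ y‖²`, and transposition preserves the spectral norm. -/
theorem sum_inner_matrixCol_sq_le {m N : ℕ} {B : Matrix (Fin m) (Fin N) ℝ} (hB : ‖B‖ ≤ 1)
    (y : EuclideanSpace ℝ (Fin m)) : ∑ i, inner ℝ (matrixCol B i) y ^ 2 ≤ ‖y‖ ^ 2 := by
  have h := Matrix.l2_opNorm_mulVec B.conjTranspose y
  rw [Matrix.l2_opNorm_conjTranspose] at h
  have h1 : ‖(EuclideanSpace.equiv (Fin N) ℝ).symm (B.conjTranspose.mulVec y)‖ ≤ ‖y‖ :=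
    h.trans (mul_le_of_le_one_left (norm_nonneg y) hB)
  have h2 := pow_le_pow_left₀ (norm_nonneg _) h1 2
  rw [EuclideanSpace.real_norm_sq_eq] at h2
  refine le_trans (le_of_eq (Finset.sum_congr rfl fun i _ => ?_)) h2
  congr 1
  simp [matrixCol, PiLp.inner_apply, Matrix.mulVec, dotProduct, mul_comm]

/-- The squared Hilbert–Schmidt norm, computed along the standard basis: each of the `m` basis
vectors contributes at most `1`. -/
theorem sum_norm_sq_le_card {m : ℕ} {ι : Type*} [Fintype ι] {b : ι → EuclideanSpace ℝ (Fin m)}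
    (hb : ∀ y, ∑ i, inner ℝ (b i) y ^ 2 ≤ ‖y‖ ^ 2) : ∑ i, ‖b i‖ ^ 2 ≤ m := by
  have h1 : ∑ i, ‖b i‖ ^ 2 =
      ∑ k, ∑ i, inner ℝ (b i) (EuclideanSpace.single k (1 : ℝ)) ^ 2 := by
    rw [Finset.sum_comm]
    refine Finset.sum_congr rfl fun i _ => ?_
    rw [EuclideanSpace.real_norm_sq_eq]
    refine Finset.sum_congr rfl fun k _ => ?_
    rw [EuclideanSpace.inner_single_right]
    simp
  rw [h1]
  refine (Finset.sum_le_sum fun k _ => hb _).trans ?_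
  simp

/-- The first `k₀` layers are kept together and the others are added by the triangle inequality.
Cauchy–Schwarz against `∑ 4⁻ᵏ |supp| ≤ 1` leaves the square root of the number of remaining layers,
the source of `√log (e/q)`. -/
theorem norm_dyadicVec_le {E : Type*} [NormedAddCommGroup E] [NormedSpace ℝ E] {n : ℕ}
    (f : EuclideanSpace ℝ (Fin n) →L[ℝ] E) {c₁ c₂ : ℝ} (hc₂ : 0 ≤ c₂) {k₀ K : ℕ} (hk : k₀ ≤ K)
    {τ : ℕ → Fin n → SignType} (h1 : ‖f (WithLp.toLp 2 (dyadicVec k₀ τ))‖ ≤ c₁)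
    (h2 : ∀ k, ‖f (WithLp.toLp 2 fun j => ((τ k j : SignType) : ℝ))‖ ≤ c₂ * √(signSupp (τ k)))
    (h3 : ∑ k ∈ Finset.range K, (4⁻¹ : ℝ) ^ k * signSupp (τ k) ≤ 1) :
    ‖f (WithLp.toLp 2 (dyadicVec K τ))‖ ≤ c₁ + c₂ * √(K - k₀ : ℕ) := by
  have hsplit : (WithLp.toLp 2 (dyadicVec K τ) : EuclideanSpace ℝ (Fin n)) =
      WithLp.toLp 2 (dyadicVec k₀ τ) + ∑ k ∈ Finset.Ico k₀ K,
        (2⁻¹ : ℝ) ^ k • WithLp.toLp 2 fun j => ((τ k j : SignType) : ℝ) := by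
    ext j
    simp only [dyadicVec, PiLp.add_apply, WithLp.ofLp_sum, Finset.sum_apply, PiLp.smul_apply,
      smul_eq_mul]
    exact (Finset.sum_range_add_sum_Ico _ hk).symm
  rw [hsplit, map_add, map_sum]
  refine (norm_add_le _ _).trans (add_le_add h1 ((norm_sum_le _ _).trans ?_))
  have h4 : ∀ k ∈ Finset.Ico k₀ K,
      ‖f ((2⁻¹ : ℝ) ^ k • WithLp.toLp 2 fun j => ((τ k j : SignType) : ℝ))‖ ≤
        c₂ * (1 * √((4⁻¹ : ℝ) ^ k * signSupp (τ k))) := fun k _ => by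
    rw [map_smul, norm_smul, Real.norm_eq_abs, abs_of_nonneg (by positivity), one_mul,
      Real.sqrt_mul (by positivity)]
    have e : √((4⁻¹ : ℝ) ^ k) = 2⁻¹ ^ k := by
      rw [Real.sqrt_eq_iff_mul_self_eq (by positivity) (by positivity), ← mul_pow]
      norm_num
    rw [e]
    calc _ ≤ (2⁻¹ : ℝ) ^ k * (c₂ * √(signSupp (τ k))) :=
          mul_le_mul_of_nonneg_left (h2 k) (by positivity)
      _ = _ := by ring
  refine (Finset.sum_le_sum h4).trans ?_
  rw [← Finset.mul_sum]
  refine mul_le_mul_of_nonneg_left ?_ hc₂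
  refine (Real.sum_mul_le_sqrt_mul_sqrt _ _ _).trans ?_
  have h5 : ∑ k ∈ Finset.Ico k₀ K, √((4⁻¹ : ℝ) ^ k * signSupp (τ k)) ^ 2 ≤ 1 := by
    refine le_trans ?_ h3
    rw [Finset.range_eq_Ico]
    refine (Finset.sum_le_sum_of_subset_of_nonneg (Finset.Ico_subset_Ico_left (Nat.zero_le k₀))
      fun _ _ _ => sq_nonneg _).trans (le_of_eq ?_)
    exact Finset.sum_congr rfl fun k _ => Real.sq_sqrt (by positivity)
  calc _ ≤ √(K - k₀ : ℕ) * √1 := by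
        refine mul_le_mul (Real.sqrt_le_sqrt (by simp)) (Real.sqrt_le_sqrt h5)
          (Real.sqrt_nonneg _) (Real.sqrt_nonneg _)
    _ = _ := by simp

/-! ### Union bounds. -/

namespace SparseFamily

variable {Ω : Type*} [MeasurableSpace Ω] {μ : Measure Ω} [IsProbabilityMeasure μ] {N n : ℕ}
  {q : ℝ} {a : Fin N → Fin n → Ω → ℝ}
  {E : Type*} [NormedAddCommGroup E] [InnerProductSpace ℝ E] [MeasurableSpace E]
  [BorelSpace E] [SecondCountableTopology E] {b : Fin N → E} {D : ℝ}

/-- With high probability all rows have a small `ℓ¹` norm. -/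
theorem measure_exists_row_le (h : SparseFamily μ q a) (hq : 0 ≤ q) (hqD : n * q ≤ D) :
    μ {ω | ∃ i, 6 * D < ∑ j, |a i j ω|} ≤ ENNReal.ofReal (N * Real.exp (-(4 * D))) := by
  have h1 : ∀ i, μ {ω | 6 * D < ∑ j, |a i j ω|} ≤ ENNReal.ofReal (Real.exp (-(4 * D))) :=
    fun i => by
      have hm := h.meas i
      refine (measure_mono fun ω hω => ?_).trans
        (((h.expBdd_row_abs hq i).measure_le (by fun_prop) (6 * D)).trans ?_)
      · exact (show 6 * D < ∑ j, |a i j ω| from hω).le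
      · exact ENNReal.ofReal_le_ofReal (Real.exp_le_exp.2 (by linarith))
  rw [show {ω | ∃ i, 6 * D < ∑ j, |a i j ω|} = ⋃ i, {ω | 6 * D < ∑ j, |a i j ω|} by ext; simp]
  refine (measure_iUnion_fintype_le _ _).trans ((Finset.sum_le_sum fun i _ => h1 i).trans ?_)
  rw [Finset.sum_const, Finset.card_univ, Fintype.card_fin, nsmul_eq_mul,
    ENNReal.ofReal_mul (by positivity), ENNReal.ofReal_natCast]

/-- Union bound over all sign vectors. -/
theorem measure_exists_level_le (h : SparseFamily μ q a) (hq : 0 ≤ q)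
    (hb : ∀ y, ∑ i, inner ℝ (b i) y ^ 2 ≤ ‖y‖ ^ 2) (hbn : ∑ i, ‖b i‖ ^ 2 ≤ n)
    (hnN : n ≤ N) (hqD : n * q ≤ D) (hND : Real.log (2 * N) ≤ D) :
    μ {ω | (∀ i, ∑ j, |a i j ω| ≤ 6 * D) ∧ ∃ σ : Fin n → SignType,
      100000 * (signSupp σ * D) < ‖∑ i, (∑ j, (σ j : ℝ) * a i j ω) • b i‖ ^ 2} ≤
      ENNReal.ofReal (n * (2 * Real.exp (-(2 * D)))) := by
  classical
  set P : (Fin n → SignType) → Set Ω := fun σ => {ω | (∀ i, ∑ j, |a i j ω| ≤ 6 * D) ∧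
      100000 * (signSupp σ * D) < ‖∑ i, (∑ j, (σ j : ℝ) * a i j ω) • b i‖ ^ 2}
  set S : Finset (Fin n → SignType) := Finset.univ.filter fun σ => 1 ≤ signSupp σ
  have hsub : {ω | (∀ i, ∑ j, |a i j ω| ≤ 6 * D) ∧ ∃ σ : Fin n → SignType,
      100000 * (signSupp σ * D) < ‖∑ i, (∑ j, (σ j : ℝ) * a i j ω) • b i‖ ^ 2} ⊆
      ⋃ σ ∈ S, P σ := by
    rintro ω ⟨hrow, σ, hσ⟩
    refine Set.mem_iUnion₂.2 ⟨σ, Finset.mem_filter.2 ⟨Finset.mem_univ _, ?_⟩, hrow, hσ⟩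
    by_contra hc
    have h0 : signSupp σ = 0 := by omega
    have hz : ∀ j, ((σ j : SignType) : ℝ) = 0 := fun j => by
      have := sum_sign_sq σ
      rw [h0, Nat.cast_zero, Finset.sum_eq_zero_iff_of_nonneg fun _ _ => sq_nonneg _] at this
      exact pow_eq_zero_iff two_ne_zero |>.1 (this j (Finset.mem_univ j))
    simp [hz, h0] at hσ
  set g : ℕ → ℝ := fun m => 2 * Real.exp (-(2 * (m * (1 + Real.log (n / m))) + 2 * D))
  have hP : ∀ σ ∈ S, μ (P σ) ≤ ENNReal.ofReal (g (signSupp σ)) := fun σ hσ =>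
    h.measure_level_le hq hb hbn hnN hqD hND (fun j => SignType.abs_coe_le _) (sum_sign_sq σ)
      (by exact_mod_cast (Finset.mem_filter.1 hσ).2) (by exact_mod_cast signSupp_le σ)
  refine (measure_mono hsub).trans ((measure_biUnion_finset_le _ _).trans
    ((Finset.sum_le_sum hP).trans ?_))
  rw [← ENNReal.ofReal_sum_of_nonneg fun _ _ => by positivity]
  refine ENNReal.ofReal_le_ofReal ?_
  -- Group by support size `m`: the number of such vectors cancels the entropy term in the tail
  -- bound, leaving `2 exp (-2D)` for each of the `n` sizes.
  rw [← Finset.sum_fiberwise_of_maps_to (t := Finset.Icc 1 n) (g := signSupp) fun σ hσ =>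
    Finset.mem_Icc.2 ⟨(Finset.mem_filter.1 hσ).2, signSupp_le σ⟩]
  have hm : ∀ m ∈ Finset.Icc 1 n, ∑ σ ∈ S with signSupp σ = m, g (signSupp σ) ≤
      2 * Real.exp (-(2 * D)) := by
    intro m hm
    rw [Finset.mem_Icc] at hm
    have e1 : ∑ σ ∈ S with signSupp σ = m, g (signSupp σ) =
        ((S.filter fun σ => signSupp σ = m).card : ℝ) * g m := by
      rw [← nsmul_eq_mul, ← Finset.sum_const]
      exact Finset.sum_congr rfl fun σ hσ => by rw [(Finset.mem_filter.1 hσ).2]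
    have e2 : ((S.filter fun σ => signSupp σ = m).card : ℝ) ≤
        Real.exp (2 * (m * (1 + Real.log (n / m)))) := by
      refine le_trans (Nat.cast_le.2 (Finset.card_le_card fun σ hσ => ?_))
        (card_signSupp_le hm.1 hm.2)
      exact Finset.mem_filter.2 ⟨Finset.mem_univ _, (Finset.mem_filter.1 hσ).2.le⟩
    rw [e1]
    calc _ ≤ Real.exp (2 * (m * (1 + Real.log (n / m)))) * g m :=
          mul_le_mul_of_nonneg_right e2 (by positivity)
      _ = 2 * Real.exp (-(2 * D)) := by
          simp only [g]
          rw [mul_left_comm, ← Real.exp_add]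
          ring_nf
  refine (Finset.sum_le_sum hm).trans ?_
  simp

/-- Union bound over all combinations of the first few dyadic layers. -/
theorem measure_exists_dyadicVec_le (h : SparseFamily μ q a) (hq : 0 ≤ q)
    (hb : ∀ y, ∑ i, inner ℝ (b i) y ^ 2 ≤ ‖y‖ ^ 2) (hbn : ∑ i, ‖b i‖ ^ 2 ≤ n)
    (hqD : n * q ≤ D) {k₀ : ℕ} (hk : ∀ k < k₀, 4 ^ k ≤ n)
    (hent : ∑ k ∈ Finset.range k₀, (4 : ℝ) ^ k * (1 + Real.log (n / 4 ^ k)) ≤ 7 * D) :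
    μ {ω | ∃ τ : ℕ → Fin n → SignType, (∀ k < k₀, signSupp (τ k) ≤ 4 ^ k) ∧
      ∑ j, dyadicVec k₀ τ j ^ 2 ≤ 1 ∧
      144 * D < ‖∑ i, (∑ j, dyadicVec k₀ τ j * a i j ω) • b i‖ ^ 2} ≤
      ENNReal.ofReal (Real.exp (-(3 * D))) := by
  classical
  set F : Fin k₀ → Finset (Fin n → SignType) := fun k => Finset.univ.filter fun σ =>
    signSupp σ ≤ 4 ^ (k : ℕ)
  -- The event depends only on the first `k₀` layers; extending these by zero makes the union
  -- finite.
  set ext : (Fin k₀ → Fin n → SignType) → ℕ → Fin n → SignType :=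
    fun t k => if hk : k < k₀ then t ⟨k, hk⟩ else 0
  set P : (Fin k₀ → Fin n → SignType) → Set Ω := fun t =>
    {ω | ∑ j, dyadicVec k₀ (ext t) j ^ 2 ≤ 1 ∧
      144 * D < ‖∑ i, (∑ j, dyadicVec k₀ (ext t) j * a i j ω) • b i‖ ^ 2}
  have hext : ∀ τ : ℕ → Fin n → SignType,
      dyadicVec k₀ (ext fun k : Fin k₀ => τ k) = dyadicVec k₀ τ := fun τ => by
    ext j
    refine Finset.sum_congr rfl fun k hk => ?_
    simp [ext, Finset.mem_range.1 hk]
  have hsub : {ω | ∃ τ : ℕ → Fin n → SignType, (∀ k < k₀, signSupp (τ k) ≤ 4 ^ k) ∧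
      ∑ j, dyadicVec k₀ τ j ^ 2 ≤ 1 ∧
      144 * D < ‖∑ i, (∑ j, dyadicVec k₀ τ j * a i j ω) • b i‖ ^ 2} ⊆
      ⋃ t ∈ Fintype.piFinset F, P t := by
    rintro ω ⟨τ, h1, h2, h3⟩
    refine Set.mem_iUnion₂.2 ⟨fun k => τ k, Fintype.mem_piFinset.2 fun k =>
      Finset.mem_filter.2 ⟨Finset.mem_univ _, h1 k k.2⟩, ?_⟩
    simp only [P, Set.mem_ofPred_eq, hext]
    exact ⟨h2, h3⟩
  have hP : ∀ t ∈ Fintype.piFinset F, μ (P t) ≤ ENNReal.ofReal (Real.exp (-(17 * D))) := by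
    intro t _
    by_cases hx : ∑ j, dyadicVec k₀ (ext t) j ^ 2 ≤ 1
    · have hmeas : ∀ i, Measurable fun ω =>
          (∑ j, dyadicVec k₀ (ext t) j * a i j ω) • b i := fun i => by
        have := h.meas i
        exact Measurable.smul_const (by fun_prop) (b i)
      refine (measure_mono fun ω hω => ?_).trans
        (((h.expBdd_norm_sq hq hb hbn hx).measure_le (by fun_prop) (18 * D)).trans ?_)
      · have := hω.2
        change 18 * D ≤ 1 / 8 * _
        linarith
      · exact ENNReal.ofReal_le_ofReal (Real.exp_le_exp.2 (by linarith))
    · refine (measure_mono (t := ∅) fun ω hω => hx hω.1).trans ?_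
      simp
  refine (measure_mono hsub).trans ((measure_biUnion_finset_le _ _).trans
    ((Finset.sum_le_sum hP).trans ?_))
  rw [Finset.sum_const, nsmul_eq_mul, ← ENNReal.ofReal_natCast,
    ← ENNReal.ofReal_mul (by positivity)]
  refine ENNReal.ofReal_le_ofReal ?_
  -- Twice the entropy `7D`. Against the single-vector tail `exp (nq - 144D/8) ≤ exp (-17D)` this
  -- leaves `exp (-3D)`.
  have hcard : ((Fintype.piFinset F).card : ℝ) ≤ Real.exp (14 * D) := by
    rw [Fintype.card_piFinset]
    push_cast
    calc ∏ k : Fin k₀, ((F k).card : ℝ)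
        ≤ ∏ k : Fin k₀, Real.exp (2 * ((4 : ℝ) ^ (k : ℕ) * (1 + Real.log (n / 4 ^ (k : ℕ))))) := by
          refine Finset.prod_le_prod (fun _ _ => by positivity) fun k _ => ?_
          have := card_signSupp_le (n := n) (s := 4 ^ (k : ℕ)) (Nat.one_le_pow _ _ (by norm_num))
            (hk k k.2)
          push_cast at this
          exact this
      _ = Real.exp (2 * ∑ k ∈ Finset.range k₀, (4 : ℝ) ^ k * (1 + Real.log (n / 4 ^ k))) := by
          rw [← Real.exp_sum, ← Finset.mul_sum, Finset.sum_range]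
      _ ≤ _ := Real.exp_le_exp.2 (by linarith)
  calc _ ≤ Real.exp (14 * D) * Real.exp (-(17 * D)) :=
        mul_le_mul_of_nonneg_right hcard (Real.exp_pos _).le
    _ = _ := by rw [← Real.exp_add]; ring_nf

end SparseFamily

/-! ### Expected norm of a sparse symmetric array. -/

/-- A crude deterministic bound. It gives integrability and is affordable on an exceptional event of
probability `1/N`. -/
theorem norm_mul_le_of_abs_le_one {m N n : ℕ} (hnN : n ≤ N) {B : Matrix (Fin m) (Fin N) ℝ}
    (hB : ‖B‖ ≤ 1) {A : Fin N → Fin n → ℝ} (hA : ∀ i j, |A i j| ≤ 1) :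
    ‖B * Matrix.of A‖ ≤ N := by
  rw [norm_mul_eq_colRowOp]
  refine ContinuousLinearMap.opNorm_le_bound _ (by positivity) fun x => ?_
  have hx : x = WithLp.toLp 2 x.ofLp := rfl
  have h1 : ‖colRowOp (matrixCol B) A x‖ ^ 2 ≤ (N * ‖x‖) ^ 2 := by
    rw [hx, colRowOp_apply, ← hx]
    refine (norm_sum_smul_sq_le (sum_inner_matrixCol_sq_le hB) _).trans ?_
    have h2 : ∀ i, (∑ j, x j * A i j) ^ 2 ≤ ‖x‖ ^ 2 * n := fun i => by
      refine (Finset.sum_mul_sq_le_sq_mul_sq _ _ _).trans ?_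
      rw [← EuclideanSpace.real_norm_sq_eq]
      refine mul_le_mul_of_nonneg_left ?_ (sq_nonneg _)
      refine (Finset.sum_le_sum fun j _ => (sq_le_one_iff_abs_le_one _).2 (hA i j)).trans ?_
      simp
    refine (Finset.sum_le_sum fun i _ => h2 i).trans ?_
    rw [Finset.sum_const, Finset.card_univ, Fintype.card_fin, nsmul_eq_mul, mul_pow]
    have h3 : (n : ℝ) ≤ N := by exact_mod_cast hnN
    have h4 := mul_le_mul_of_nonneg_left h3 (show (0 : ℝ) ≤ N * ‖x‖ ^ 2 by positivity)
    linarith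
  exact le_of_sq_le_sq h1 (by positivity)

theorem continuous_norm_mul {m N n : ℕ} (B : Matrix (Fin m) (Fin N) ℝ) :
    Continuous fun A : Fin N → Fin n → ℝ => ‖B * Matrix.of A‖ := by
  have h : Continuous fun A : Fin N → Fin n → ℝ => B * Matrix.of A :=
    Continuous.matrix_mul continuous_const continuous_id
  exact h.norm

theorem measurable_norm_mul {Ω : Type*} [MeasurableSpace Ω] {m N n : ℕ}
    (B : Matrix (Fin m) (Fin N) ℝ) {a : Fin N → Fin n → Ω → ℝ} (ha : ∀ i j, Measurable (a i j)) :
    Measurable fun ω => ‖B * Matrix.of (fun i j => a i j ω)‖ :=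
  (continuous_norm_mul B).measurable.comp
    (measurable_pi_lambda _ fun i => measurable_pi_lambda _ fun j => ha i j)

theorem integral_le_of_measure_lt_le {Ω : Type*} [MeasurableSpace Ω] {μ : Measure Ω}
    [IsProbabilityMeasure μ] {Z : Ω → ℝ} (hZ : Measurable Z) {c K ε : ℝ} (hc : 0 ≤ c)
    (hK : 0 ≤ K) (hε : 0 ≤ ε) (hZ0 : ∀ ω, 0 ≤ Z ω) (hZK : ∀ ω, Z ω ≤ K)
    (h : μ {ω | c < Z ω} ≤ ENNReal.ofReal ε) : ∫ ω, Z ω ∂μ ≤ c + K * ε := by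
  rw [integral_eq_lintegral_of_nonneg_ae (Filter.Eventually.of_forall hZ0)
    hZ.aestronglyMeasurable]
  refine ENNReal.toReal_le_of_le_ofReal (by positivity) ?_
  have hs : MeasurableSet {ω | c < Z ω} := measurableSet_lt measurable_const hZ
  calc ∫⁻ ω, ENNReal.ofReal (Z ω) ∂μ
      ≤ ∫⁻ ω, (ENNReal.ofReal c + {ω | c < Z ω}.indicator (fun _ => ENNReal.ofReal K) ω) ∂μ := by
        refine lintegral_mono fun ω => ?_
        by_cases hω : ω ∈ {ω | c < Z ω}
        · rw [Set.indicator_of_mem hω]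
          exact (ENNReal.ofReal_le_ofReal (hZK ω)).trans le_add_self
        · rw [Set.indicator_of_notMem hω, add_zero]
          exact ENNReal.ofReal_le_ofReal (not_lt.1 hω)
    _ = ENNReal.ofReal c + ENNReal.ofReal K * μ {ω | c < Z ω} := by
        rw [lintegral_add_left measurable_const, lintegral_indicator_const hs]
        simp
    _ ≤ ENNReal.ofReal c + ENNReal.ofReal K * ENNReal.ofReal ε := by gcongr
    _ = _ := by
        rw [← ENNReal.ofReal_mul hK, ← ENNReal.ofReal_add hc (by positivity)]

/-- The range of dyadic scales which have to be treated one by one. -/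
theorem exists_dyadic_range {n : ℕ} {q : ℝ} (hn : 0 < n) (hq : 0 < q) (hq1 : q ≤ 1) :
    ∃ k₀ K : ℕ, k₀ ≤ K + 1 ∧ 16 * n ≤ 4 ^ K ∧
      (∀ k < k₀, (4 : ℝ) ^ k ≤ n * q / Real.log (Real.exp 1 / q)) ∧
      ((K + 1 - k₀ : ℕ) : ℝ) ≤ 6 * Real.log (Real.exp 1 / q) := by
  have hn0 : (0 : ℝ) < n := by exact_mod_cast hn
  have hn1 : (1 : ℝ) ≤ n := by exact_mod_cast hn
  set L := Real.log (Real.exp 1 / q) with hL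
  have hLq : L = 1 - Real.log q := by rw [hL, Real.log_div (Real.exp_pos 1).ne' hq.ne', Real.log_exp]
  have hlq : Real.log q ≤ 0 := Real.log_nonpos hq.le hq1
  have hL1 : 1 ≤ L := by linarith
  have hL0 : 0 < L := by linarith
  set M := n * q / L with hM
  have hM0 : 0 < M := by positivity
  have hMn : M ≤ n := by
    rw [hM, div_le_iff₀ hL0]
    nlinarith
  have hex1 : ∃ k : ℕ, M < 4 ^ k := pow_unbounded_of_one_lt M (by norm_num)
  have hex2 : ∃ K : ℕ, 16 * n ≤ 4 ^ K := by
    obtain ⟨K, hK⟩ := pow_unbounded_of_one_lt (16 * n) (show 1 < 4 by norm_num)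
    exact ⟨K, hK.le⟩
  set k₀ := Nat.find hex1
  set K := Nat.find hex2
  have h1 : M < 4 ^ k₀ := Nat.find_spec hex1
  have h2 : 16 * n ≤ 4 ^ K := Nat.find_spec hex2
  have h3 : ∀ k < k₀, (4 : ℝ) ^ k ≤ M := fun k hk => not_lt.1 (Nat.find_min hex1 hk)
  have h4 : (4 : ℝ) ^ K ≤ 64 * n := by
    rcases Nat.eq_zero_or_pos K with h0 | h0
    · rw [h0, pow_zero]; linarith
    · have h5 : ¬16 * n ≤ 4 ^ (K - 1) := Nat.find_min hex2 (Nat.sub_lt h0 one_pos)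
      have h6 : 4 ^ K = 4 * 4 ^ (K - 1) := by
        conv_lhs => rw [← Nat.sub_add_cancel h0, pow_succ]
        ring
      have h7 : 4 ^ K ≤ 64 * n := by omega
      exact_mod_cast h7
  have h5 : k₀ ≤ K := by
    refine Nat.find_min' hex1 ?_
    have : (16 * n : ℝ) ≤ 4 ^ K := by exact_mod_cast h2
    linarith
  refine ⟨k₀, K, by omega, h2, h3, ?_⟩
  -- Minimality gives `4ᴷ ≤ 64n`, while `4^k₀` exceeds `nq/L`. Hence the number of layers in between
  -- is logarithmic in `L/q`, that is, `O(L)`.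
  have h6 : (4 : ℝ) ^ (K + 1 - k₀) ≤ 256 * L / q := by
    rw [pow_sub₀ _ (by norm_num) (by omega), pow_succ, ← div_eq_mul_inv,
      div_le_div_iff₀ (by positivity) hq]
    have h7 : n * q < 4 ^ k₀ * L := by rwa [hM, div_lt_iff₀ hL0] at h1
    nlinarith
  have h7 := Real.log_le_log (by positivity) h6
  rw [Real.log_pow, Real.log_div (by positivity) hq.ne', Real.log_mul (by norm_num) hL0.ne'] at h7
  have h8 : Real.log 256 = 8 * Real.log 2 := by
    rw [show (256 : ℝ) = 2 ^ 8 by norm_num, Real.log_pow]; norm_num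
  have h9 : Real.log 4 = 2 * Real.log 2 := by
    rw [show (4 : ℝ) = 2 ^ 2 by norm_num, Real.log_pow]; norm_num
  have h10 := Real.log_le_sub_one_of_pos hL0
  have h11 := Real.log_two_gt_d9
  have h12 := Real.log_two_lt_d9
  rw [h8, h9] at h7
  have h13 : (0 : ℝ) ≤ ((K + 1 - k₀ : ℕ) : ℝ) := by positivity
  nlinarith

/-- The estimate for arrays with small first absolute moments. -/
theorem SparseFamily.integral_norm_le {Ω : Type*} [MeasurableSpace Ω] {μ : Measure Ω}
    [IsProbabilityMeasure μ] {N n : ℕ} {q : ℝ} {a : Fin N → Fin n → Ω → ℝ}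
    (h : SparseFamily μ q a) (hq : 0 < q) (hq1 : q ≤ 1) (hn : 0 < n) (hnN : n ≤ N)
    {B : Matrix (Fin n) (Fin N) ℝ} (hB : ‖B‖ ≤ 1) :
    ∫ ω, ‖B * Matrix.of (fun i j => a i j ω)‖ ∂μ ≤
      4000 * √(Real.log (Real.exp 1 / q)) * √(n * q + Real.log (2 * N)) := by
  have hn0 : (0 : ℝ) < n := by exact_mod_cast hn
  have hN : 0 < N := hn.trans_le hnN
  have hN0 : (0 : ℝ) < N := by exact_mod_cast hN
  have hN1 : (1 : ℝ) ≤ N := by exact_mod_cast hN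
  have hnN' : (n : ℝ) ≤ N := by exact_mod_cast hnN
  set L := Real.log (Real.exp 1 / q) with hL
  have hLq : L = 1 - Real.log q := by rw [hL, Real.log_div (Real.exp_pos 1).ne' hq.ne', Real.log_exp]
  have hlq : Real.log q ≤ 0 := Real.log_nonpos hq.le hq1
  have hL1 : 1 ≤ L := by linarith
  have hL0 : 0 < L := by linarith
  have hlogN : Real.log 2 ≤ Real.log (2 * N) := Real.log_le_log two_pos (by linarith)
  set D := n * q + Real.log (2 * N) with hD
  have hqD : n * q ≤ D := by linarith [Real.log_two_gt_d9]
  have hND : Real.log (2 * N) ≤ D := by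
    have : 0 ≤ n * q := by positivity
    linarith
  have hD1 : 1 / 4 ≤ D := by linarith [Real.log_two_gt_d9]
  have hb := fun y => sum_inner_matrixCol_sq_le hB y
  have hbn : ∑ i, ‖matrixCol B i‖ ^ 2 ≤ n := sum_norm_sq_le_card hb
  obtain ⟨k₀, K, hk₀K, hK, hk, hKL⟩ := exists_dyadic_range hn hq hq1
  rw [← hL] at hk hKL
  set M := n * q / L with hM
  have hM0 : 0 < M := by positivity
  have hMq : M ≤ n * q := div_le_self (by positivity) hL1
  have hMn : M ≤ n := hMq.trans (mul_le_of_le_one_right hn0.le hq1)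
  -- With `M = nq/L` and `1 + log (n/M) ≤ 2L`, the entropy is at most `(8/3) nq + 4M ≤ (20/3) nq`.
  have hent : ∑ k ∈ Finset.range k₀, (4 : ℝ) ^ k * (1 + Real.log (n / 4 ^ k)) ≤ 7 * D := by
    refine (sum_level_entropy_le hM0 hMn hk).trans ?_
    have h1 : Real.log (n / M) = Real.log L - Real.log q := by
      rw [← Real.log_div hL0.ne' hq.ne', hM]
      congr 1
      field_simp
    have h2 : 1 + Real.log (n / M) ≤ 2 * L := by
      rw [h1]; linarith [Real.log_le_sub_one_of_pos hL0]
    have h3 : M * L = n * q := div_mul_cancel₀ _ hL0.ne'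
    have h4 := mul_le_mul_of_nonneg_left h2 hM0.le
    linarith
  have hk4 : ∀ k < k₀, 4 ^ k ≤ n := fun k hk' => by
    have := (hk k hk').trans hMn
    exact_mod_cast this
  set c := 4 * (√(144 * D) + √(100000 * D) * √(K + 1 - k₀ : ℕ)) with hc
  have hbad : {ω | c < ‖B * Matrix.of (fun i j => a i j ω)‖} ⊆
      {ω | ∃ i, 6 * D < ∑ j, |a i j ω|} ∪
      ({ω | (∀ i, ∑ j, |a i j ω| ≤ 6 * D) ∧ ∃ σ : Fin n → SignType,
        100000 * (signSupp σ * D) < ‖∑ i, (∑ j, (σ j : ℝ) * a i j ω) • matrixCol B i‖ ^ 2} ∪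
      {ω | ∃ τ : ℕ → Fin n → SignType, (∀ k < k₀, signSupp (τ k) ≤ 4 ^ k) ∧
        ∑ j, dyadicVec k₀ τ j ^ 2 ≤ 1 ∧
        144 * D < ‖∑ i, (∑ j, dyadicVec k₀ τ j * a i j ω) • matrixCol B i‖ ^ 2}) := by
    intro ω hω
    by_contra hgood
    simp only [Set.mem_union, Set.mem_ofPred_eq, not_or, not_exists, not_and, not_lt] at hgood
    obtain ⟨g1, g2, g3⟩ := hgood
    have g2' := g2 g1
    have hω' : c < ‖B * Matrix.of (fun i j => a i j ω)‖ := hω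
    refine absurd hω' (not_lt.2 ?_)
    rw [norm_mul_eq_colRowOp]
    refine opNorm_le_of_dyadicVec hK _ (by positivity) fun τ h1 h2 => ?_
    refine norm_dyadicVec_le _ (by positivity) hk₀K ?_ (fun k => ?_) h2
    · rw [colRowOp_apply]
      refine Real.le_sqrt_of_sq_le (g3 τ (fun k hk' => ?_) (h1 k₀))
      have h3 : (4⁻¹ : ℝ) ^ k * signSupp (τ k) ≤ 1 :=
        (Finset.single_le_sum (f := fun k => (4⁻¹ : ℝ) ^ k * signSupp (τ k))
          (fun _ _ => by positivity) (Finset.mem_range.2 (by omega))).trans h2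
      rw [inv_pow, inv_mul_le_iff₀ (by positivity), mul_one] at h3
      exact_mod_cast h3
    · rw [colRowOp_apply, ← Real.sqrt_mul (by positivity)]
      refine Real.le_sqrt_of_sq_le ((g2' (τ k)).trans (le_of_eq (by ring)))
  have hexp : Real.exp (-D) ≤ 1 / (2 * N) := by
    rw [Real.exp_neg, one_div]
    refine inv_anti₀ (by positivity) ?_
    calc 2 * (N : ℝ) = Real.exp (Real.log (2 * N)) := (Real.exp_log (by positivity)).symm
      _ ≤ _ := Real.exp_le_exp.2 hND
  -- The three union bounds give `N e⁻⁴ᴰ + 2n e⁻²ᴰ + e⁻³ᴰ ≤ 4N e⁻²ᴰ`, and `e⁻ᴰ ≤ 1/(2N)`. The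
  -- exceptional event then adds only `N · (1/N) = 1` to the expectation.
  have hprob : μ {ω | c < ‖B * Matrix.of (fun i j => a i j ω)‖} ≤ ENNReal.ofReal (1 / N) := by
    refine (measure_mono hbad).trans ((measure_union_le _ _).trans ((add_le_add
      (h.measure_exists_row_le hq.le hqD) ((measure_union_le _ _).trans (add_le_add
      (h.measure_exists_level_le hq.le hb hbn hnN hqD hND)
      (h.measure_exists_dyadicVec_le hq.le hb hbn hqD hk4 hent)))).trans ?_))
    rw [← ENNReal.ofReal_add (by positivity) (by positivity),
      ← ENNReal.ofReal_add (by positivity) (by positivity)]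
    refine ENNReal.ofReal_le_ofReal ?_
    set e := Real.exp (-D) with he
    have he0 : 0 < e := Real.exp_pos _
    have he1 : e ≤ 1 := Real.exp_le_one_iff.2 (by linarith)
    have e2 : Real.exp (-(2 * D)) = e ^ 2 := by rw [he, ← Real.exp_nat_mul]; push_cast; ring_nf
    have e3 : Real.exp (-(3 * D)) = e ^ 3 := by rw [he, ← Real.exp_nat_mul]; push_cast; ring_nf
    have e4 : Real.exp (-(4 * D)) = e ^ 4 := by rw [he, ← Real.exp_nat_mul]; push_cast; ring_nf
    rw [e2, e3, e4]
    have f1 : e ^ 4 ≤ e ^ 2 := pow_le_pow_of_le_one he0.le he1 (by norm_num)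
    have f2 : e ^ 3 ≤ e ^ 2 := pow_le_pow_of_le_one he0.le he1 (by norm_num)
    have f3 : e ^ 2 ≤ 1 / (4 * N ^ 2) := by
      calc e ^ 2 ≤ (1 / (2 * N)) ^ 2 := pow_le_pow_left₀ he0.le hexp 2
        _ = _ := by field_simp; norm_num
    have f4 : (4 * (N : ℝ)) * (1 / (4 * N ^ 2)) = 1 / N := by field_simp
    have f5 := mul_le_mul_of_nonneg_left f3 (show (0 : ℝ) ≤ 4 * N by positivity)
    have f6 := mul_le_mul_of_nonneg_left f1 hN0.le
    have f7 := mul_le_mul_of_nonneg_right hnN' (show 0 ≤ 2 * e ^ 2 by positivity)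
    have f8 := mul_le_mul_of_nonneg_right hN1 (show 0 ≤ e ^ 2 by positivity)
    linarith
  have hfin := integral_le_of_measure_lt_le (measurable_norm_mul B h.meas) (c := c) (K := N)
    (by positivity) hN0.le (by positivity) (fun ω => norm_nonneg _)
    (fun ω => norm_mul_le_of_abs_le_one hnN hB fun i j => h.abs_le_one i j ω) hprob
  refine hfin.trans ?_
  rw [mul_one_div_cancel hN0.ne']
  have s1 : √(144 * D) = 12 * √D := by
    rw [Real.sqrt_mul (by norm_num), show (144 : ℝ) = 12 ^ 2 by norm_num,
      Real.sqrt_sq (by norm_num)]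
  have s2 : √(100000 * D) ≤ 320 * √D := by
    rw [Real.sqrt_le_left (by positivity), mul_pow, Real.sq_sqrt (by linarith)]
    linarith
  have s3 : √(K + 1 - k₀ : ℕ) ≤ 5 / 2 * √L := by
    rw [Real.sqrt_le_left (by positivity), mul_pow, Real.sq_sqrt hL0.le]
    linarith
  have s4 : 1 ≤ √L := Real.one_le_sqrt.2 hL1
  have s5 : 1 / 2 ≤ √D := by
    refine Real.le_sqrt_of_sq_le ?_
    linarith
  have s6 := mul_le_mul s2 s3 (Real.sqrt_nonneg _) (by positivity)
  have s7 : √D ≤ √L * √D := le_mul_of_one_le_left (Real.sqrt_nonneg _) s4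
  rw [hc, s1]
  nlinarith

/-! ### Decomposition of the entries by size. -/

/-- The part of `x` at scale `2 ^ (-l)`, rescaled to size one. The last scale `J` collects
everything which is smaller. -/
noncomputable def scalePart (J l : ℕ) (x : ℝ) : ℝ :=
  2 ^ l * (trunc (2⁻¹ ^ l) x - if l < J then trunc (2⁻¹ ^ (l + 1)) x else 0)

theorem measurable_scalePart (J l : ℕ) : Measurable (scalePart J l) := by
  have h1 := measurable_trunc (2⁻¹ ^ l)
  have h2 := measurable_trunc (2⁻¹ ^ (l + 1))
  unfold scalePart
  split_ifs <;> fun_prop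

theorem scalePart_neg (J l : ℕ) (x : ℝ) : scalePart J l (-x) = -scalePart J l x := by
  unfold scalePart
  split_ifs <;> simp only [trunc_neg] <;> ring

theorem sum_scalePart (J : ℕ) {x : ℝ} (hx : |x| ≤ 1) :
    ∑ l ∈ Finset.range (J + 1), 2⁻¹ ^ l * scalePart J l x = x := by
  have h1 : ∀ l, (2⁻¹ : ℝ) ^ l * scalePart J l x =
      trunc (2⁻¹ ^ l) x - if l < J then trunc (2⁻¹ ^ (l + 1)) x else 0 := fun l => by
    unfold scalePart
    rw [← mul_assoc, ← mul_pow]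
    norm_num
  simp_rw [h1]
  rw [Finset.sum_range_succ, if_neg (lt_irrefl J), sub_zero]
  have h2 : ∑ l ∈ Finset.range J, (trunc ((2⁻¹ : ℝ) ^ l) x -
      if l < J then trunc (2⁻¹ ^ (l + 1)) x else 0) =
      trunc (2⁻¹ ^ 0) x - trunc (2⁻¹ ^ J) x := by
    rw [← Finset.sum_range_sub' (fun l => trunc ((2⁻¹ : ℝ) ^ l) x)]
    exact Finset.sum_congr rfl fun l hl => by rw [if_pos (Finset.mem_range.1 hl)]
  rw [h2, sub_add_cancel]
  simp [trunc, hx]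

theorem abs_trunc_sub_trunc_le {R S : ℝ} (hR : 0 ≤ R) (hSR : S ≤ R) (x : ℝ) :
    |trunc R x - trunc S x| ≤ R := by
  unfold trunc
  split_ifs with h1 h2 h2
  · simpa using hR
  · simpa using h1
  · exact absurd (h2.trans hSR) h1
  · simpa using hR

theorem abs_scalePart_le_one (J l : ℕ) (x : ℝ) : |scalePart J l x| ≤ 1 := by
  have hpow : (2 : ℝ) ^ l * 2⁻¹ ^ l = 1 := by rw [← mul_pow]; norm_num
  have hlt : (2⁻¹ : ℝ) ^ (l + 1) < 2⁻¹ ^ l := by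
    rw [pow_succ]
    linarith [show (0 : ℝ) < 2⁻¹ ^ l by positivity]
  have key : |trunc ((2⁻¹ : ℝ) ^ l) x - if l < J then trunc (2⁻¹ ^ (l + 1)) x else 0| ≤
      2⁻¹ ^ l := by
    split_ifs
    · exact abs_trunc_sub_trunc_le (by positivity) hlt.le x
    · rw [sub_zero]
      exact abs_trunc_le (by positivity) x
  unfold scalePart
  rw [abs_mul, abs_of_nonneg (by positivity)]
  calc _ ≤ (2 : ℝ) ^ l * 2⁻¹ ^ l := mul_le_mul_of_nonneg_left key (by positivity)
    _ = 1 := hpow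

/-- Where the part is nonzero, `2^(l+1) |x| > 1`, so one factor `|x|` can be traded for a square.
This converts the second moment of the entry into a first moment of the rescaled part. It needs the
lower cutoff, absent at `l = J`. -/
theorem abs_scalePart_le_sq {J l : ℕ} (hl : l < J) (x : ℝ) :
    |scalePart J l x| ≤ 2 * 4 ^ l * x ^ 2 := by
  have hlt : (2⁻¹ : ℝ) ^ (l + 1) < 2⁻¹ ^ l := by
    rw [pow_succ]
    linarith [show (0 : ℝ) < 2⁻¹ ^ l by positivity]
  have h4 : (4 : ℝ) ^ l = 2 ^ l * 2 ^ l := by rw [← mul_pow]; norm_num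
  have h0 : (0 : ℝ) ≤ 2 * 4 ^ l * x ^ 2 := by positivity
  unfold scalePart
  rw [if_pos hl]
  unfold trunc
  split_ifs with h1 h2 h2
  · simpa using h0
  · rw [sub_zero, abs_mul, abs_of_nonneg (by positivity)]
    push Not at h2
    have h3 : 1 ≤ 2 * (2 ^ l * |x|) := by
      have : (2 : ℝ) * 2 ^ l * 2⁻¹ ^ (l + 1) = 1 := by
        rw [pow_succ, ← mul_assoc, mul_assoc 2, ← mul_pow]; norm_num
      have h5 := mul_le_mul_of_nonneg_left h2.le (show (0 : ℝ) ≤ 2 * 2 ^ l by positivity)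
      linarith
    rw [h4, ← sq_abs x]
    have h6 := mul_le_mul_of_nonneg_right h3 (show (0 : ℝ) ≤ 2 ^ l * |x| by positivity)
    nlinarith
  · exact absurd (h2.trans hlt.le) h1
  · simpa using h0

/-- `J = ⌈-log p⌉` works because `log 4 ≥ 1`. At the last scale the trivial moment bound `1` then
loses nothing, since `4ᴶ p ≥ 1`. -/
theorem exists_scale {p : ℝ} (hp : 0 < p) (hp1 : p ≤ 1) :
    ∃ J : ℕ, 1 ≤ 4 ^ J * p ∧ (J + 1 : ℝ) ≤ 2 * Real.log (Real.exp 1 / p) := by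
  have hL : Real.log (Real.exp 1 / p) = 1 - Real.log p := by
    rw [Real.log_div (Real.exp_pos 1).ne' hp.ne', Real.log_exp]
  have hlp : Real.log p ≤ 0 := Real.log_nonpos hp.le hp1
  have hlog4 : 1 ≤ Real.log 4 := by
    rw [show (4 : ℝ) = 2 ^ 2 by norm_num, Real.log_pow]
    push_cast
    linarith [Real.log_two_gt_d9]
  refine ⟨⌈-Real.log p⌉₊, ?_, ?_⟩
  · have h1 : -Real.log p ≤ ⌈-Real.log p⌉₊ := Nat.le_ceil _
    rw [← Real.log_nonneg_iff (by positivity), Real.log_mul (by positivity) hp.ne', Real.log_pow]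
    have h2 : (0 : ℝ) ≤ ⌈-Real.log p⌉₊ := by positivity
    nlinarith
  · have h1 := Nat.ceil_lt_add_one (show 0 ≤ -Real.log p by linarith)
    rw [hL]
    rcases eq_or_lt_of_le hlp with h0 | h0
    · rw [h0]; norm_num
    · by_cases h2 : -Real.log p ≤ 1
      · have : ⌈-Real.log p⌉₊ ≤ 1 := Nat.ceil_le.2 (by exact_mod_cast h2)
        have h3 : ((⌈-Real.log p⌉₊ : ℕ) : ℝ) ≤ 1 := by exact_mod_cast this
        linarith
      · push Not at h2
        linarith

/-- The estimate for arrays of independent symmetric bounded random variables. -/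
theorem integral_norm_le_of_symm {Ω : Type*} [MeasurableSpace Ω] {μ : Measure Ω}
    [IsProbabilityMeasure μ] {N n : ℕ} {p : ℝ} {a : Fin N → Fin n → Ω → ℝ}
    (ham : ∀ i j, Measurable (a i j))
    (hind : iIndepFun (fun ij : Fin N × Fin n => a ij.1 ij.2) μ)
    (hsymm : ∃ T : Ω → Ω, MeasurePreserving T μ μ ∧ ∀ i j ω, a i j (T ω) = -a i j ω)
    (ha1 : ∀ i j ω, |a i j ω| ≤ 1)
    (hap : ∀ i j, ∫⁻ ω, ENNReal.ofReal (a i j ω ^ 2) ∂μ ≤ ENNReal.ofReal p)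
    (hp : 0 < p) (hp1 : p ≤ 1) (hn : 0 < n) (hnN : n ≤ N)
    {B : Matrix (Fin n) (Fin N) ℝ} (hB : ‖B‖ ≤ 1) :
    ∫ ω, ‖B * Matrix.of (fun i j => a i j ω)‖ ∂μ ≤
      16000 * (Real.log (Real.exp 1 / p) * √(Real.log (Real.exp 1 / p))) *
        √(n * p + Real.log (2 * N)) := by
  obtain ⟨T, hT, haT⟩ := hsymm
  obtain ⟨J, hJ, hJL⟩ := exists_scale hp hp1
  have hL : Real.log (Real.exp 1 / p) = 1 - Real.log p := by
    rw [Real.log_div (Real.exp_pos 1).ne' hp.ne', Real.log_exp]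
  have hlp : Real.log p ≤ 0 := Real.log_nonpos hp.le hp1
  set L := Real.log (Real.exp 1 / p)
  have hN1 : (1 : ℝ) ≤ N := by exact_mod_cast hn.trans_le hnN
  have hlogN : 0 ≤ Real.log (2 * N) := Real.log_nonneg (by linarith)
  set q : ℕ → ℝ := fun l => min 1 (2 * 4 ^ l * p)
  have hq0 : ∀ l, 0 < q l := fun l => lt_min one_pos (by positivity)
  have hfam : ∀ l ∈ Finset.range (J + 1),
      SparseFamily μ (q l) fun i j ω => scalePart J l (a i j ω) := by
    intro l hl
    refine ⟨fun i j => (measurable_scalePart J l).comp (ham i j),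
      hind.comp (fun _ => scalePart J l) fun _ => measurable_scalePart J l,
      ⟨T, hT, fun i j ω => by rw [haT, scalePart_neg]⟩,
      fun i j ω => abs_scalePart_le_one J l _, fun i j => ?_⟩
    have h1 : ∫⁻ ω, ENNReal.ofReal |scalePart J l (a i j ω)| ∂μ ≤ ENNReal.ofReal 1 := by
      refine (lintegral_mono fun ω => ENNReal.ofReal_le_ofReal
        (abs_scalePart_le_one J l (a i j ω))).trans ?_
      simp
    rcases lt_or_ge l J with hlJ | hlJ
    · have h2 : ∫⁻ ω, ENNReal.ofReal |scalePart J l (a i j ω)| ∂μ ≤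
          ENNReal.ofReal (2 * 4 ^ l * p) := by
        calc _ ≤ ∫⁻ ω, ENNReal.ofReal (2 * 4 ^ l) * ENNReal.ofReal (a i j ω ^ 2) ∂μ := by
              refine lintegral_mono fun ω => ?_
              rw [← ENNReal.ofReal_mul (by positivity)]
              exact ENNReal.ofReal_le_ofReal (abs_scalePart_le_sq hlJ _)
          _ ≤ ENNReal.ofReal (2 * 4 ^ l) * ENNReal.ofReal p := by
              rw [lintegral_const_mul' _ _ ENNReal.ofReal_ne_top]
              gcongr
              exact hap i j
          _ = _ := by rw [← ENNReal.ofReal_mul (by positivity)]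
      simp only [q]
      rcases min_choice 1 (2 * 4 ^ l * p) with h | h <;> rw [h] <;> assumption
    · have hlJ' : l = J := le_antisymm (Nat.lt_succ_iff.1 (Finset.mem_range.1 hl)) hlJ
      have h3 : q l = 1 := min_eq_left (by rw [hlJ']; linarith)
      rw [h3]
      exact h1
  have hdecomp : ∀ ω, B * Matrix.of (fun i j => a i j ω) = ∑ l ∈ Finset.range (J + 1),
      (2⁻¹ : ℝ) ^ l • (B * Matrix.of (fun i j => scalePart J l (a i j ω))) := fun ω => by
    simp_rw [← Matrix.mul_smul]
    rw [← Matrix.mul_sum]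
    congr 1
    ext i j
    rw [Matrix.sum_apply]
    simp only [Matrix.smul_apply, Matrix.of_apply, smul_eq_mul]
    exact (sum_scalePart J (ha1 i j ω)).symm
  have hint : ∀ l, Integrable
      (fun ω => ‖B * Matrix.of (fun i j => scalePart J l (a i j ω))‖) μ := fun l => by
    refine Integrable.of_bound (C := N) (measurable_norm_mul B fun i j =>
      (measurable_scalePart J l).comp (ham i j)).aestronglyMeasurable
      (Filter.Eventually.of_forall fun ω => ?_)
    rw [norm_norm]
    exact norm_mul_le_of_abs_le_one hnN hB fun i j => abs_scalePart_le_one _ _ _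
  have hlevel : ∀ l ∈ Finset.range (J + 1),
      2⁻¹ ^ l * ∫ ω, ‖B * Matrix.of (fun i j => scalePart J l (a i j ω))‖ ∂μ ≤
        4000 * √L * √(2 * (n * p + Real.log (2 * N))) := fun l hl => by
    have h1 := (hfam l hl).integral_norm_le (hq0 l) (min_le_left _ _) hn hnN hB
    have hpq : p ≤ q l := by
      refine le_min hp1 ?_
      have : (1 : ℝ) ≤ 4 ^ l := one_le_pow₀ (by norm_num)
      nlinarith
    have h2 : Real.log (Real.exp 1 / q l) ≤ L :=
      Real.log_le_log (div_pos (Real.exp_pos 1) (hq0 l))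
        (div_le_div_of_nonneg_left (Real.exp_pos 1).le hp hpq)
    -- The square of the scale, `4⁻ˡ`, cancels the growth of `q l ≤ 2·4ˡ p`: every scale contributes
    -- the same `2np`.
    have h3 : (2⁻¹ : ℝ) ^ l * √(n * q l + Real.log (2 * N)) ≤
        √(2 * (n * p + Real.log (2 * N))) := by
      refine Real.le_sqrt_of_sq_le ?_
      have hpow : ((2⁻¹ : ℝ) ^ l) ^ 2 * 4 ^ l = 1 := by
        rw [← pow_mul, mul_comm l 2, pow_mul, ← mul_pow]; norm_num
      have hle : ((2⁻¹ : ℝ) ^ l) ^ 2 ≤ 1 :=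
        pow_le_one₀ (by positivity) (pow_le_one₀ (by norm_num) (by norm_num))
      have h4 := mul_le_mul_of_nonneg_right hle hlogN
      have h5 : n * q l ≤ n * (2 * 4 ^ l * p) :=
        mul_le_mul_of_nonneg_left (min_le_right _ _) (by positivity)
      have h6 := mul_le_mul_of_nonneg_left h5 (show 0 ≤ ((2⁻¹ : ℝ) ^ l) ^ 2 by positivity)
      have h7 : ((2⁻¹ : ℝ) ^ l) ^ 2 * (n * (2 * 4 ^ l * p)) = 2 * (n * p) := by
        calc _ = 2 * (n * p) * (((2⁻¹ : ℝ) ^ l) ^ 2 * 4 ^ l) := by ring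
          _ = _ := by rw [hpow, mul_one]
      have h8 : 0 ≤ n * q l + Real.log (2 * N) :=
        add_nonneg (mul_nonneg (by positivity) (hq0 l).le) hlogN
      rw [mul_pow, Real.sq_sqrt h8]
      linarith
    calc _ ≤ (2⁻¹ : ℝ) ^ l * (4000 * √(Real.log (Real.exp 1 / q l)) *
          √(n * q l + Real.log (2 * N))) := mul_le_mul_of_nonneg_left h1 (by positivity)
      _ = 4000 * √(Real.log (Real.exp 1 / q l)) *
          ((2⁻¹ : ℝ) ^ l * √(n * q l + Real.log (2 * N))) := by ring
      _ ≤ _ := by gcongr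
  have hbound : ∫ ω, ‖B * Matrix.of (fun i j => a i j ω)‖ ∂μ ≤
      ∑ l ∈ Finset.range (J + 1),
        2⁻¹ ^ l * ∫ ω, ‖B * Matrix.of (fun i j => scalePart J l (a i j ω))‖ ∂μ := by
    simp_rw [← integral_const_mul]
    rw [← integral_finsetSum _ fun l _ => (hint l).const_mul _]
    refine integral_mono_of_nonneg (Filter.Eventually.of_forall fun ω => norm_nonneg _)
      (integrable_finsetSum _ fun l _ => (hint l).const_mul _)
      (Filter.Eventually.of_forall fun ω => ?_)
    beta_reduce
    rw [hdecomp ω]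
    refine (norm_sum_le _ _).trans (le_of_eq (Finset.sum_congr rfl fun l _ => ?_))
    rw [norm_smul, Real.norm_eq_abs, abs_of_nonneg (by positivity)]
  refine hbound.trans ((Finset.sum_le_sum hlevel).trans ?_)
  rw [Finset.sum_const, Finset.card_range, nsmul_eq_mul]
  push_cast
  have hs2 : √(2 * (n * p + Real.log (2 * N))) ≤ 2 * √(n * p + Real.log (2 * N)) := by
    rw [Real.sqrt_le_left (by positivity), mul_pow, Real.sq_sqrt (by positivity)]
    nlinarith [show 0 ≤ n * p + Real.log (2 * N) by positivity]
  calc ((J : ℝ) + 1) * (4000 * √L * √(2 * (n * p + Real.log (2 * N))))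
      ≤ (2 * L) * (4000 * √L * (2 * √(n * p + Real.log (2 * N)))) := by
        refine mul_le_mul hJL ?_ (by positivity) (by linarith)
        exact mul_le_mul_of_nonneg_left hs2 (by positivity)
    _ = _ := by ring

/-! ### Symmetrization and conclusion. -/

/-- Pairing an independent family with an independent copy gives an independent family. -/
theorem ProbabilityTheory.iIndepFun.pair_prod {Ω ι : Type*} [Fintype ι] [MeasurableSpace Ω]
    {μ : Measure Ω} [IsProbabilityMeasure μ] {X : ι → Ω → ℝ} (hX : ∀ i, Measurable (X i))
    (hind : iIndepFun X μ) :
    iIndepFun (fun i (z : Ω × Ω) => (X i z.1, X i z.2)) (μ.prod μ) := by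
  have : ∀ i, IsProbabilityMeasure (μ.map (X i)) :=
    fun i => Measure.isProbabilityMeasure_map (hX i).aemeasurable
  rw [iIndepFun_iff_map_fun_eq_pi_map fun i => by
    have := hX i
    fun_prop]
  have h1 : ∀ i, (μ.prod μ).map (fun z : Ω × Ω => (X i z.1, X i z.2)) =
      (μ.map (X i)).prod (μ.map (X i)) := fun i =>
    (Measure.map_prod_map μ μ (hX i) (hX i)).symm
  simp_rw [h1]
  have hXm : Measurable fun ω i => X i ω := measurable_pi_lambda _ hX
  rw [← ((measurePreserving_arrowProdEquivProdArrow ℝ ℝ ι (fun i => μ.map (X i))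
    fun i => μ.map (X i)).symm).map_eq, ← hind.map_fun_eq_pi_map fun i => (hX i).aemeasurable,
    Measure.map_prod_map μ μ hXm hXm, Measure.map_map (by fun_prop) (by fun_prop)]
  rfl

/-- Symmetrization: a centered random matrix is controlled by its difference with an independent
copy. -/
theorem integral_norm_le_symmetrization {Ω : Type*} [MeasurableSpace Ω] {μ : Measure Ω}
    [IsProbabilityMeasure μ] {N n : ℕ} {a : Fin N → Fin n → Ω → ℝ}
    (ham : ∀ i j, Measurable (a i j)) (ha0 : ∀ i j, ∫ ω, a i j ω ∂μ = 0)
    (ha1 : ∀ i j, ∀ᵐ ω ∂μ, |a i j ω| ≤ 1) (hnN : n ≤ N)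
    {B : Matrix (Fin n) (Fin N) ℝ} (hB : ‖B‖ ≤ 1) :
    Integrable (fun ω => ‖B * Matrix.of (fun i j => a i j ω)‖) μ ∧
    ∫ ω, ‖B * Matrix.of (fun i j => a i j ω)‖ ∂μ ≤
      2 * ∫ z, ‖B * Matrix.of (fun i j => trunc 1 ((a i j z.1 - a i j z.2) / 2))‖ ∂(μ.prod μ) := by
  have hall : ∀ᵐ ω ∂μ, ∀ i j, |a i j ω| ≤ 1 :=
    ae_all_iff.2 fun i => ae_all_iff.2 fun j => ha1 i j
  have hint : Integrable (fun ω => ‖B * Matrix.of (fun i j => a i j ω)‖) μ := by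
    refine Integrable.of_bound (C := N) (measurable_norm_mul B ham).aestronglyMeasurable
      (hall.mono fun ω hω => ?_)
    rw [norm_norm]
    exact norm_mul_le_of_abs_le_one hnN hB hω
  refine ⟨hint, ?_⟩
  have hai : ∀ i j, Integrable (a i j) μ := fun i j =>
    Integrable.of_bound (ham i j).aestronglyMeasurable 1 (ha1 i j)
  -- Almost surely the truncation changes nothing, as the halved difference is bounded by `1`. It
  -- makes the bound hold everywhere and keeps the symmetry.
  set Y : Fin N → Fin n → Ω × Ω → ℝ := fun i j z => trunc 1 ((a i j z.1 - a i j z.2) / 2)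
  have hYm : ∀ i j, Measurable (Y i j) := fun i j => by
    have := ham i j
    exact (measurable_trunc 1).comp (by fun_prop)
  have hYint : Integrable (fun z => ‖B * Matrix.of (fun i j => Y i j z)‖) (μ.prod μ) := by
    refine Integrable.of_bound (C := N) (measurable_norm_mul B hYm).aestronglyMeasurable
      (Filter.Eventually.of_forall fun z => ?_)
    rw [norm_norm]
    exact norm_mul_le_of_abs_le_one hnN hB fun i j => abs_trunc_le zero_le_one _
  let G : (Fin N → Fin n → ℝ) →L[ℝ] Matrix (Fin n) (Fin n) ℝ :=
    LinearMap.toContinuousLinearMap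
      { toFun := fun A => B * Matrix.of A
        map_add' := fun A A' => Matrix.mul_add B (Matrix.of A) (Matrix.of A')
        map_smul' := fun c A => Matrix.mul_smul B c (Matrix.of A) }
  have hG : ∀ A, G A = B * Matrix.of A := fun A => rfl
  have hpt : ∀ᵐ ω ∂μ, ‖B * Matrix.of (fun i j => a i j ω)‖ ≤
      ∫ ω', 2 * ‖B * Matrix.of (fun i j => Y i j (ω, ω'))‖ ∂μ := by
    filter_upwards [hall] with ω hω
    have hd : ∀ i, Integrable (fun ω' => fun j => a i j ω - a i j ω') μ := fun i =>
      Integrable.of_eval fun j => (integrable_const _).sub (hai i j)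
    have hd2 : Integrable (fun ω' => fun i j => a i j ω - a i j ω') μ := Integrable.of_eval hd
    -- Centering: averaging over the independent copy recovers the original matrix, so Jensen's
    -- inequality for the norm applies.
    have h1 : ∫ ω', (fun i j => a i j ω - a i j ω') ∂μ = fun i j => a i j ω := by
      ext i j
      have hd' : ∀ j, Integrable (fun ω' => a i j ω - a i j ω') μ := fun j =>
        (integrable_const _).sub (hai i j)
      rw [eval_integral hd, eval_integral hd', integral_sub (integrable_const _) (hai i j), ha0]
      simp
    rw [← hG, ← h1, ← ContinuousLinearMap.integral_comp_comm G hd2]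
    refine (norm_integral_le_integral_norm _).trans (le_of_eq (integral_congr_ae ?_))
    filter_upwards [hall] with ω' hω'
    have h2 : (fun i j => a i j ω - a i j ω') = (2 : ℝ) • fun i j => Y i j (ω, ω') := by
      ext i j
      have h3 : |(a i j ω - a i j ω') / 2| ≤ 1 := by
        rw [abs_div, abs_two, div_le_one two_pos]
        exact (abs_sub _ _).trans (by linarith [hω i j, hω' i j])
      simp only [Y, trunc, if_pos h3, Pi.smul_apply, smul_eq_mul]
      ring
    rw [h2, map_smul, norm_smul, hG]
    simp
  calc ∫ ω, ‖B * Matrix.of (fun i j => a i j ω)‖ ∂μ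
      ≤ ∫ ω, ∫ ω', 2 * ‖B * Matrix.of (fun i j => Y i j (ω, ω'))‖ ∂μ ∂μ :=
        integral_mono_ae hint (hYint.const_mul 2).integral_prod_left hpt
    _ = ∫ z, 2 * ‖B * Matrix.of (fun i j => Y i j z)‖ ∂(μ.prod μ) :=
        (integral_prod _ (hYint.const_mul 2)).symm
    _ = _ := integral_const_mul _ _

theorem mainTheorem6 :
    ∃ C : ℝ, 0 < C ∧
      ∀ (n N : ℕ), 0 < n → n ≤ N →
      ∀ (p : ℝ), 0 < p → p ≤ 1 →
      ∀ (Ω : Type*) [MeasurableSpace Ω] (μ : Measure Ω) [IsProbabilityMeasure μ]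
        (a : Fin N → Fin n → Ω → ℝ),
        (∀ i j, Measurable (a i j)) →
        iIndepFun (fun (ij : Fin N × Fin n) => a ij.1 ij.2) μ →
        (∀ i j, ∫ ω, a i j ω ∂μ = 0) →
        (∀ i j, ∫ ω, |a i j ω| ^ 2 ∂μ ≤ p) →
        (∀ i j, ∀ᵐ ω ∂μ, |a i j ω| ≤ 1) →
      ∀ (B : Matrix (Fin n) (Fin N) ℝ), ‖B‖ ≤ 1 →
        Integrable (fun ω => ‖B * Matrix.of (fun i j => a i j ω)‖) μ ∧
        ∫ ω, ‖B * Matrix.of (fun i j => a i j ω)‖ ∂μ ≤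
          C * Real.log (Real.exp 1 / p) ^ (3 / 2 : ℝ) *
            Real.sqrt (n * p + Real.log (2 * N)) := by
  -- The symmetric estimate `16000` times the factor `2` lost in symmetrization.
  refine ⟨32000, by norm_num, ?_⟩
  intro n N hn hnN p hp hp1 Ω _ μ _ a ham hind ha0 hap ha1 B hB
  obtain ⟨hint, hle⟩ := integral_norm_le_symmetrization ham ha0 ha1 hnN hB
  refine ⟨hint, hle.trans ?_⟩
  set Y : Fin N → Fin n → Ω × Ω → ℝ := fun i j z => trunc 1 ((a i j z.1 - a i j z.2) / 2)
  have htr : Measurable fun x : ℝ × ℝ => trunc 1 ((x.1 - x.2) / 2) :=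
    (measurable_trunc 1).comp (by fun_prop)
  have hYm : ∀ i j, Measurable (Y i j) := fun i j => by
    have := ham i j
    exact (measurable_trunc 1).comp (by fun_prop)
  have hYind : iIndepFun (fun ij : Fin N × Fin n => Y ij.1 ij.2) (μ.prod μ) :=
    (ProbabilityTheory.iIndepFun.pair_prod (fun ij : Fin N × Fin n => ham ij.1 ij.2) hind).comp
      (fun _ x => trunc 1 ((x.1 - x.2) / 2)) fun _ => htr
  have hasq : ∀ i j, ∫⁻ ω, ENNReal.ofReal (a i j ω ^ 2) ∂μ ≤ ENNReal.ofReal p := fun i j => by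
    have hi : Integrable (fun ω => a i j ω ^ 2) μ :=
      Integrable.of_bound (C := 1) ((ham i j).pow_const 2).aestronglyMeasurable
        ((ha1 i j).mono fun ω hω => by
          rw [Real.norm_eq_abs, abs_of_nonneg (sq_nonneg _)]
          exact (sq_le_one_iff_abs_le_one _).2 hω)
    rw [← ofReal_integral_eq_lintegral_ofReal hi (Filter.Eventually.of_forall fun _ => sq_nonneg _)]
    refine ENNReal.ofReal_le_ofReal ?_
    have h := hap i j
    simp_rw [sq_abs] at h
    exact h
  have hYp : ∀ i j, ∫⁻ z, ENNReal.ofReal (Y i j z ^ 2) ∂(μ.prod μ) ≤ ENNReal.ofReal p := by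
    intro i j
    have hm : Measurable fun ω => ENNReal.ofReal (a i j ω ^ 2) :=
      ((ham i j).pow_const 2).ennreal_ofReal
    -- Halving the difference keeps the second moment at most `p`, since `((x - y)/2)² ≤ (x² +
    -- y²)/2`.
    have hpt : ∀ z : Ω × Ω, ENNReal.ofReal (Y i j z ^ 2) ≤
        2⁻¹ * (ENNReal.ofReal (a i j z.1 ^ 2) + ENNReal.ofReal (a i j z.2 ^ 2)) := fun z => by
      have h2 : (2⁻¹ : ENNReal) = ENNReal.ofReal 2⁻¹ := by
        rw [ENNReal.ofReal_inv_of_pos two_pos]; simp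
      rw [h2, ← ENNReal.ofReal_add (sq_nonneg _) (sq_nonneg _),
        ← ENNReal.ofReal_mul (by norm_num)]
      refine ENNReal.ofReal_le_ofReal ?_
      have h3 := pow_le_pow_left₀ (abs_nonneg _)
        (abs_trunc_le_abs 1 ((a i j z.1 - a i j z.2) / 2)) 2
      rw [sq_abs, sq_abs] at h3
      refine h3.trans ?_
      nlinarith [sq_nonneg (a i j z.1 + a i j z.2)]
    refine (lintegral_mono hpt).trans ?_
    have hm1 : Measurable fun z : Ω × Ω => ENNReal.ofReal (a i j z.1 ^ 2) :=
      hm.comp measurable_fst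
    rw [lintegral_const_mul' _ _ (by simp), lintegral_add_left hm1,
      measurePreserving_fst.lintegral_comp hm, measurePreserving_snd.lintegral_comp hm]
    calc _ ≤ (2⁻¹ : ENNReal) * (ENNReal.ofReal p + ENNReal.ofReal p) := by
          gcongr <;> exact hasq i j
      _ = ENNReal.ofReal p := by
          rw [← two_mul, ← mul_assoc, ENNReal.inv_mul_cancel (by simp) (by simp), one_mul]
  have hsymm : ∃ T : Ω × Ω → Ω × Ω, MeasurePreserving T (μ.prod μ) (μ.prod μ) ∧
      ∀ i j z, Y i j (T z) = -Y i j z := by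
    refine ⟨Prod.swap, Measure.measurePreserving_swap, fun i j z => ?_⟩
    simp only [Y, Prod.fst_swap, Prod.snd_swap]
    rw [← trunc_neg]
    congr 1
    ring
  have hmain := integral_norm_le_of_symm hYm hYind hsymm (fun i j z => abs_trunc_le zero_le_one _)
    hYp hp hp1 hn hnN hB
  have hL0 : 0 < Real.log (Real.exp 1 / p) := by
    rw [Real.log_div (Real.exp_pos 1).ne' hp.ne', Real.log_exp]
    linarith [Real.log_nonpos hp.le hp1]
  have hpow : Real.log (Real.exp 1 / p) ^ (3 / 2 : ℝ) =
      Real.log (Real.exp 1 / p) * √(Real.log (Real.exp 1 / p)) := by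
    rw [show (3 / 2 : ℝ) = 1 + 1 / 2 by norm_num, Real.rpow_add hL0, Real.rpow_one,
      Real.sqrt_eq_rpow]
  rw [hpow]
  linarith
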